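/- **Theorem 1.** For a finite simple graph $G$ whose edges carry weights in $[0,\infty]$, let $\mathrm{dist}(u,v)\in[0,\infty]$ be the minimum length of a path from $u$ to $v$ in $G$ (with value $\infty$ if there is no path). For $\varepsilon>0$, an *$\varepsilon$-ladder* of length $\ell$ is a sequence $(x_i,p_i)_{i=1}^{\ell}$ of pairs of vertices such that for some real $r>0$ we have $\mathrm{dist}(p_j,x_i)\le r$ for all $1\le j<i\le \ell$, and $\mathrm{dist}(p_i,x_i)>(1+\varepsilon)r$ for all $1\le i\le \ell$. The *$\varepsilon$-scatter dimension* is the length of a longest $\varepsilon$-ladder. For every integer $h\ge 1$ and real $\varepsilon>0$, if $G$ is a finite edge-weighted $K_h$-minor-free graph, then the $\varepsilon$-scatter dimension of the metric induced by $G$ is at most $$\left(6c\cdot(9\varepsilon^{-1}+2)^c\right)^{c+1},\qquad\text{where}\qquad c=\binom{h-2+2\lceil 36h\varepsilon^{-1}\rceil}{h-1}\cdot(12+72\varepsilon^{-1})\cdot(h-1).$$ In particular, there is an absolute constant $C$ such that for every integer $h\ge 1$ and real $0<\varepsilon\le h$, the $\varepsilon$-scatter dimension of the metric induced by any finite edge-weighted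 $K_h$-minor-free graph is at most $2^{(h\varepsilon^{-1})^{C h}}$. -/

import Mathlib

open scoped ENNReal

universe u

noncomputable section

/-- `H` is a minor of `G`: there are pairwise disjoint branch sets in `G`, one for each vertex
of `H`, each inducing a (nonempty) connected subgraph of `G`, such that the branch sets of
adjacent vertices of `H` are joined by an edge of `G`. -/
def IsGraphMinor {W V : Type*} (H : SimpleGraph W) (G : SimpleGraph V) : Prop :=
  ∃ B : W → Set V,
    (∀ a, (G.induce (B a)).Connected) ∧
    (∀ a b, a ≠ b → Disjoint (B a) (B b)) ∧
    (∀ a b, H.Adj a b → ∃ u ∈ B a, ∃ v ∈ B b, G.Adj u v)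

/-- `G` is `K_h`-minor-free. -/
def CliqueMinorFree {V : Type*} (G : SimpleGraph V) (h : ℕ) : Prop :=
  ¬ IsGraphMinor (⊤ : SimpleGraph (Fin h)) G

/-- The length of a walk: the sum of the weights of the edges it traverses. -/
def walkLength {V : Type*} {G : SimpleGraph V} (w : Sym2 V → ℝ≥0∞) {u v : V}
    (q : G.Walk u v) : ℝ≥0∞ :=
  (q.edges.map w).sum

/-- The distance in the graph `G` with edge weights `w` (only the values of `w` on edges of `G`
matter): the minimum length of a walk, and `∞` if there is no walk. -/
def graphMetric {V : Type*} (G : SimpleGraph V) (w : Sym2 V → ℝ≥0∞) (u v : V) : ℝ≥0∞ :=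
  ⨅ q : G.Walk u v, walkLength w q

/-- The pairs `(x i, p i)` form an `ε`-ladder of width `r` with respect to the distance `d`. -/
def IsLadderOfWidth {V : Type*} (d : V → V → ℝ≥0∞) (ε r : ℝ) {l : ℕ} (x p : Fin l → V) : Prop :=
  (∀ i j, j < i → d (p j) (x i) ≤ ENNReal.ofReal r) ∧
  (∀ i, ENNReal.ofReal ((1 + ε) * r) < d (p i) (x i))

/-- The pairs `(x i, p i)` form an `ε`-ladder with respect to the distance `d`. -/
def IsLadder {V : Type*} (d : V → V → ℝ≥0∞) (ε : ℝ) {l : ℕ} (x p : Fin l → V) : Prop :=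
  ∃ r : ℝ, 0 < r ∧ IsLadderOfWidth d ε r x p

/-- The `ε`-scatter dimension: the supremum of the lengths of all `ε`-ladders. -/
def scatterDim {V : Type*} (d : V → V → ℝ≥0∞) (ε : ℝ) : ℕ∞ :=
  ⨆ (l : ℕ) (_ : ∃ x p : Fin l → V, IsLadder d ε x p), (l : ℕ∞)

/-- The quantity `c = binom(h - 2 + 2⌈36hε⁻¹⌉, h - 1) * (12 + 72ε⁻¹) * (h - 1)`. For `h ≥ 1` and
`ε > 0` no natural-number subtraction truncates. -/
def reachBound (h : ℕ) (ε : ℝ) : ℝ :=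
  ((h + 2 * ⌈36 * (h : ℝ) * ε⁻¹⌉₊ - 2).choose (h - 1) : ℝ) * (12 + 72 * ε⁻¹) * ((h : ℝ) - 1)

/-- The bound `(6c * (9ε⁻¹ + 2)^c)^(c+1)`, with real exponents, where `c = reachBound h ε`. -/
def scatterBound (h : ℕ) (ε : ℝ) : ℝ :=
  (6 * reachBound h ε * (9 * ε⁻¹ + 2) ^ (reachBound h ε)) ^ (reachBound h ε + 1)

end

open scoped NNReal

/-! Ladders are bounded by counting with centers (`IsLadderOfWidth.length_le_of_centers`). Suppose
every vertex has at most `c` centers, and any two vertices at distance at most `r` share a center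
through which the detour costs at most `(1 + 3ε/4)r`. Let `K` be a set of centers common to all `x
i` under consideration, and group the indices by the distances from `x i` to `K`, rounded to
multiples of `εr/4`. If `j` is the first index of a group and `i` another one, the center shared by
`p j` and `x i` is not in `K`, since otherwise `p j` would reach `x j` within `(1 + ε)r`. It is
therefore one of at most `c` new centers, and `K` can be enlarged. This cannot happen more than `c`
times.

The centers come from a buffered decomposition (`PartialDecomp`). Parts are carved one by one out of
components of unassigned vertices. A new part is a union of nearly shortest paths from a root
towards the earlier parts that the component sees. These parts are pairwise adjacent and, with the
component, form a clique minor, so there are at most `h - 2` of them. A component that comes too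
close to an earlier part `X` without seeing it is first eaten into: the later parts around it grow
by `γ` (`exists_grow`). Each growth is charged to a new back part, so every vertex stays within `γ *
(back i).card` of a path. In the end the back relation is chordal, and a part is farther than `γ`
from every earlier part that is not one of its back parts, along walks avoiding still earlier parts.

On a walk of length about `r`, let `z` be a vertex in the earliest part. The buffers imply that this
part is `O(h/ε)` back steps away from the parts of both ends (`mem_hops_of_walkIn`), and chordality
gives a binomial bound on the number of such parts (`card_hops_le`). Nets on their skeleton paths
supply the centers (`exists_centers`). -/

/-- There is a walk of length `L` from `u` to `v` all of whose vertices lie in `D`. -/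
inductive WalkIn {V : Type*} (G : SimpleGraph V) (w : Sym2 V → ℝ≥0) (D : Set V) :
    V → V → ℝ → Prop
  | nil {u : V} (hu : u ∈ D) : WalkIn G w D u u 0
  | cons {u v z : V} {L : ℝ} (hu : u ∈ D) (huv : G.Adj u v) (p : WalkIn G w D v z L) :
      WalkIn G w D u z (w s(u, v) + L)

/-! ### Splitting walks inside a vertex set. -/

namespace WalkIn

variable {V : Type*} {G : SimpleGraph V} {w : Sym2 V → ℝ≥0} {D D' A : Set V} {u v z : V}
  {L M : ℝ}

theorem mem_left (p : WalkIn G w D u v L) : u ∈ D := by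
  cases p <;> assumption

theorem mem_right (p : WalkIn G w D u v L) : v ∈ D := by
  induction p with
  | nil hu => exact hu
  | cons _ _ _ ih => exact ih

theorem nonneg (p : WalkIn G w D u v L) : 0 ≤ L := by
  induction p with
  | nil hu => exact le_rfl
  | cons _ _ _ ih => exact add_nonneg (NNReal.coe_nonneg _) ih

theorem mono (p : WalkIn G w D u v L) (h : D ⊆ D') : WalkIn G w D' u v L := by
  induction p with
  | nil hu => exact .nil (h hu)
  | cons hu huv _ ih => exact .cons (h hu) huv ih

theorem append (p : WalkIn G w D u v L) (q : WalkIn G w D v z M) :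
    WalkIn G w D u z (L + M) := by
  induction p with
  | nil hu => simpa using q
  | cons hu huv _ ih => rw [add_assoc]; exact .cons hu huv (ih q)

theorem edge (hu : u ∈ D) (hv : v ∈ D) (h : G.Adj u v) : WalkIn G w D u v (w s(u, v)) := by
  simpa using WalkIn.cons hu h (.nil hv)

theorem symm (p : WalkIn G w D u v L) : WalkIn G w D v u L := by
  induction p with
  | nil hu => exact .nil hu
  | cons hu huv p ih =>
    have := ih.append (edge p.mem_left hu huv.symm)
    rwa [Sym2.eq_swap, add_comm] at this

/-- Splitting a walk at the first edge that leaves `A`. -/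
theorem exists_exit (p : WalkIn G w D u v L) (hu : u ∈ A) (hv : v ∉ A) :
    ∃ a y L₁ L₂, a ∈ A ∧ y ∉ A ∧ G.Adj a y ∧ WalkIn G w (D ∩ A) u a L₁ ∧ WalkIn G w D y v L₂ ∧
      L₁ + w s(a, y) + L₂ = L := by
  induction p with
  | nil _ => exact absurd hu hv
  | @cons u u' z L huD huv p ih =>
    by_cases hu' : u' ∈ A
    · obtain ⟨a, y, L₁, L₂, ha, hy, hay, q₁, q₂, hL⟩ := ih hu' hv
      exact ⟨a, y, _, L₂, ha, hy, hay, .cons ⟨huD, hu⟩ huv q₁, q₂, by rw [← hL]; ring⟩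
    · exact ⟨u, u', 0, L, hu, hu', huv, .nil ⟨huD, hu⟩, p, by ring⟩

/-- Splitting a walk at the last edge that enters `A`. -/
theorem exists_entry (p : WalkIn G w D u v L) (hu : u ∉ A) (hv : v ∈ A) :
    ∃ b a L₁ L₂, b ∉ A ∧ a ∈ A ∧ G.Adj b a ∧ WalkIn G w D u b L₁ ∧ WalkIn G w (D ∩ A) a v L₂ ∧
      L₁ + w s(b, a) + L₂ = L := by
  obtain ⟨a, b, L₂, L₁, ha, hb, hab, q₂, q₁, hL⟩ := p.symm.exists_exit hv hu
  exact ⟨b, a, L₁, L₂, hb, ha, hab.symm, q₁.symm, q₂.symm, by rw [Sym2.eq_swap]; linarith⟩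

/-- A walk that starts in a set with no edge to the rest of `D` stays in this set. -/
theorem inter_of_closed (p : WalkIn G w D u v L) (hu : u ∈ A)
    (h : ∀ x ∈ A, ∀ y, G.Adj x y → y ∈ D → y ∈ A) : WalkIn G w (D ∩ A) u v L := by
  induction p with
  | nil hD => exact .nil ⟨hD, hu⟩
  | cons hD huv p ih => exact .cons ⟨hD, hu⟩ huv (ih (h _ hu _ huv p.mem_left))

/-- Splitting a walk at a vertex that minimizes `f`. -/
theorem exists_min {ι : Type*} [LinearOrder ι] (f : V → ι) (p : WalkIn G w D u v L) :
    ∃ z L₁ L₂, WalkIn G w {x | x ∈ D ∧ f z ≤ f x} u z L₁ ∧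
      WalkIn G w {x | x ∈ D ∧ f z ≤ f x} z v L₂ ∧ L₁ + L₂ = L := by
  induction p with
  | @nil u hu => exact ⟨u, 0, 0, .nil ⟨hu, le_rfl⟩, .nil ⟨hu, le_rfl⟩, by simp⟩
  | @cons u u' v L hu huv p ih =>
    obtain ⟨z, L₁, L₂, q₁, q₂, hL⟩ := ih
    rcases le_total (f z) (f u) with h | h
    · exact ⟨z, _, L₂, .cons ⟨hu, h⟩ huv q₁, q₂, by rw [← hL]; ring⟩
    · refine ⟨u, 0, _, .nil ⟨hu, le_rfl⟩, .cons ⟨hu, le_rfl⟩ huv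
        ((q₁.append q₂).mono fun x hx => ⟨hx.1, h.trans hx.2⟩), by rw [← hL]; ring⟩

/-- The vertex set of a walk, with the splittings of the walk at pairs of its vertices. -/
theorem exists_support (p : WalkIn G w D u v L) :
    ∃ Q ⊆ D, u ∈ Q ∧ v ∈ Q ∧ ∀ q ∈ Q, ∀ q' ∈ Q, ∃ L₁ M L₂, L₁ + M + L₂ = L ∧
      ((WalkIn G w Q u q L₁ ∧ WalkIn G w Q q q' M ∧ WalkIn G w Q q' v L₂) ∨
        (WalkIn G w Q u q' L₁ ∧ WalkIn G w Q q' q M ∧ WalkIn G w Q q v L₂)) := by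
  induction p with
  | @nil u hu =>
    refine ⟨{u}, by simpa using hu, rfl, rfl, ?_⟩
    rintro q rfl q' rfl
    exact ⟨0, 0, 0, by simp, .inl ⟨.nil rfl, .nil rfl, .nil rfl⟩⟩
  | @cons u u' v L hu huv p ih =>
    obtain ⟨Q, hQD, hu', hv, h⟩ := ih
    have hsub : Q ⊆ insert u Q := Set.subset_insert _ _
    have huQ : u ∈ insert u Q := Set.mem_insert _ _
    refine ⟨insert u Q, Set.insert_subset hu hQD, huQ, hsub hv, ?_⟩
    have from_start : ∀ q ∈ insert u Q, ∃ M L₂, M + L₂ = w s(u, u') + L ∧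
        WalkIn G w (insert u Q) u q M ∧ WalkIn G w (insert u Q) q v L₂ := by
      rintro q (rfl | hq)
      · obtain ⟨L₁, M, L₂, hL, ⟨a, b, c⟩ | ⟨a, b, c⟩⟩ := h u' hu' u' hu'
        all_goals
          exact ⟨0, _, zero_add _, .nil huQ,
            .cons huQ huv (hL ▸ ((a.append b).append c).mono hsub)⟩
      · obtain ⟨L₁, M, L₂, hL, ⟨a, b, c⟩ | ⟨a, b, c⟩⟩ := h q hq q hq
        all_goals
          exact ⟨_, L₂, by rw [← hL]; ring, .cons huQ huv ((a.append b).mono hsub), c.mono hsub⟩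
    rintro q (rfl | hq) q' (rfl | hq')
    · obtain ⟨M, L₂, hM, a, b⟩ := from_start _ huQ
      exact ⟨0, M, L₂, by rw [← hM]; ring, .inl ⟨.nil huQ, a, b⟩⟩
    · obtain ⟨M, L₂, hM, a, b⟩ := from_start q' (hsub hq')
      exact ⟨0, M, L₂, by rw [← hM]; ring, .inl ⟨.nil huQ, a, b⟩⟩
    · obtain ⟨M, L₂, hM, a, b⟩ := from_start q (hsub hq)
      exact ⟨0, M, L₂, by rw [← hM]; ring, .inr ⟨.nil huQ, a, b⟩⟩
    · obtain ⟨L₁, M, L₂, hL, H⟩ := h q hq q' hq'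
      refine ⟨w s(u, u') + L₁, M, L₂, by rw [← hL]; ring, H.imp ?_ ?_⟩ <;>
      · rintro ⟨a, b, c⟩
        exact ⟨.cons huQ huv (a.mono hsub), b.mono hsub, c.mono hsub⟩

end WalkIn

/-! ### Distances inside a vertex set, near-geodesics and Voronoi cells. -/

section Distance

variable {V : Type*} {G : SimpleGraph V} {w : Sym2 V → ℝ≥0} {D : Set V} {a b u v : V} {L : ℝ}

/-- The distance from `a` to `v` inside the vertex set `D`. -/
noncomputable def distIn (G : SimpleGraph V) (w : Sym2 V → ℝ≥0) (D : Set V) (a v : V) : ℝ :=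
  sInf {L | WalkIn G w D a v L}

theorem distIn_le (p : WalkIn G w D a v L) : distIn G w D a v ≤ L :=
  csInf_le ⟨0, fun _ q => WalkIn.nonneg q⟩ p

theorem exists_walkIn_lt (h : ∃ L, WalkIn G w D a v L) {η : ℝ} (hη : 0 < η) :
    ∃ L, WalkIn G w D a v L ∧ L < distIn G w D a v + η := by
  obtain ⟨L, p, hL⟩ := exists_lt_of_csInf_lt (s := {L | WalkIn G w D a v L}) h
    (lt_add_of_pos_right _ hη)
  exact ⟨L, p, hL⟩

theorem distIn_le_add (h : ∃ L, WalkIn G w D a u L) (p : WalkIn G w D u v L) :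
    distIn G w D a v ≤ distIn G w D a u + L := by
  refine le_of_forall_pos_le_add fun η hη => ?_
  obtain ⟨M, q, hM⟩ := exists_walkIn_lt h hη
  linarith [distIn_le (q.append p)]

theorem abs_distIn_sub_le (h : ∃ L, WalkIn G w D a u L) (p : WalkIn G w D u v L) :
    |distIn G w D a u - distIn G w D a v| ≤ L := by
  obtain ⟨M, q⟩ := h
  rw [abs_le]
  constructor <;> linarith [distIn_le_add ⟨M, q⟩ p, distIn_le_add ⟨_, q.append p⟩ p.symm]

/-- A nearly shortest path from `a` to `b` in `D`, as a vertex set. -/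
theorem exists_geodesic (h : ∃ L, WalkIn G w D a b L) {η : ℝ} (hη : 0 < η) :
    ∃ Q ⊆ D, a ∈ Q ∧ b ∈ Q ∧ (∀ q ∈ Q, ∃ L, WalkIn G w Q a q L) ∧
      ∀ q ∈ Q, ∀ q' ∈ Q, ∃ L, WalkIn G w Q q q' L ∧
        L ≤ |distIn G w D a q - distIn G w D a q'| + η := by
  obtain ⟨L, p, hL⟩ := exists_walkIn_lt h hη
  obtain ⟨Q, hQ, ha, hb, H⟩ := p.exists_support
  have key : ∀ {q q' L₁ M L₂}, L₁ + M + L₂ = L → WalkIn G w Q a q L₁ → WalkIn G w Q q q' M →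
      WalkIn G w Q q' b L₂ → M ≤ |distIn G w D a q - distIn G w D a q'| + η := by
    intro q q' L₁ M L₂ hsum p₁ p₂ p₃
    have h₁ := distIn_le (p₁.mono hQ)
    have h₂ := distIn_le_add ⟨_, (p₁.append p₂).mono hQ⟩ (p₃.mono hQ)
    have h₃ := neg_abs_le (distIn G w D a q - distIn G w D a q')
    linarith
  refine ⟨Q, hQ, ha, hb, fun q hq => ?_, fun q hq q' hq' => ?_⟩
  · obtain ⟨L₁, M, L₂, _, ⟨p₁, _, _⟩ | ⟨p₁, _, _⟩⟩ := H q hq q hq <;> exact ⟨_, p₁⟩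
  · obtain ⟨L₁, M, L₂, hsum, ⟨p₁, p₂, p₃⟩ | ⟨p₁, p₂, p₃⟩⟩ := H q hq q' hq'
    · exact ⟨M, p₂, key hsum p₁ p₂ p₃⟩
    · exact ⟨M, p₂.symm, by rw [abs_sub_comm]; exact key hsum p₁ p₂ p₃⟩

/-- Dijkstra's algorithm: the vertices of `H` at distance at most `γ` from `S` can be distributed
among the labels of `S` so that every vertex is reached inside its own part. -/
theorem exists_voronoi [Finite V] {ι : Type*} (H S : Set V) (lab : V → ι) {γ : ℝ} (hγ : 0 ≤ γ) :
    ∃ (A : Set V) (g : V → ι), S ⊆ A ∧ A ⊆ H ∪ S ∧ (∀ b ∈ S, g b = lab b) ∧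
      (∀ v ∈ A, ∃ b ∈ S, g b = g v ∧ ∃ L ≤ γ, WalkIn G w {x | x ∈ A ∧ g x = g v} b v L) ∧
      ∀ b ∈ S, ∀ v ∈ H \ A, ∀ L, WalkIn G w (H ∪ S) b v L → γ < L := by
  classical
  -- Invariant of the greedy process: `dst v` is attained by a walk inside the cell of `v` and is a
  -- lower bound for all walks from `S`.
  have main : ∀ (n : ℕ) (A : Set V) (g : V → ι) (dst : V → ℝ), (H \ A).ncard = n → S ⊆ A →
      A ⊆ H ∪ S → (∀ b ∈ S, g b = lab b) → (∀ v ∈ A, dst v ≤ γ) →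
      (∀ v ∈ A, ∃ b ∈ S, g b = g v ∧ WalkIn G w {x | x ∈ A ∧ g x = g v} b v (dst v)) →
      (∀ v ∈ A, ∀ b ∈ S, ∀ L, WalkIn G w (H ∪ S) b v L → dst v ≤ L) →
      ∃ (A : Set V) (g : V → ι), S ⊆ A ∧ A ⊆ H ∪ S ∧ (∀ b ∈ S, g b = lab b) ∧
      (∀ v ∈ A, ∃ b ∈ S, g b = g v ∧ ∃ L ≤ γ, WalkIn G w {x | x ∈ A ∧ g x = g v} b v L) ∧
      ∀ b ∈ S, ∀ v ∈ H \ A, ∀ L, WalkIn G w (H ∪ S) b v L → γ < L := by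
    intro n
    induction n using Nat.strong_induction_on with
    | _ n ih =>
    intro A g dst hn hSA hAH hlab hle hwalk hmin
    let P : Set (V × V) := {x | x.1 ∈ A ∧ x.2 ∈ H \ A ∧ G.Adj x.1 x.2}
    by_cases hP : ∃ x ∈ P, dst x.1 + w s(x.1, x.2) ≤ γ
    · obtain ⟨x₀, hx₀, hx₀γ⟩ := hP
      obtain ⟨⟨a, y⟩, ⟨ha, hy, hay⟩, hmin'⟩ := Set.exists_min_image P
        (fun x => dst x.1 + w s(x.1, x.2)) P.toFinite ⟨x₀, hx₀⟩
      simp only at ha hy hay hmin'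
      have hyA : y ∉ A := hy.2
      have hne : ∀ x ∈ A, x ≠ y := fun x hx h => hyA (h ▸ hx)
      have hlt : (H \ insert y A).ncard < n := by
        rw [← hn]
        refine Set.ncard_lt_ncard ⟨fun x hx => ⟨hx.1, fun h => hx.2 (.inr h)⟩, fun h => ?_⟩
          (Set.toFinite _)
        exact (h hy).2 (.inl rfl)
      refine ih _ hlt (insert y A) (Function.update g y (g a))
        (Function.update dst y (dst a + w s(a, y))) rfl (hSA.trans (Set.subset_insert _ _))
        (Set.insert_subset (.inl hy.1) hAH) ?_ ?_ ?_ ?_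
      · intro b hb
        rw [Function.update_of_ne (hne b (hSA hb)), hlab b hb]
      · rintro v (rfl | hv)
        · rw [Function.update_self]
          exact (hmin' x₀ hx₀).trans hx₀γ
        · rw [Function.update_of_ne (hne v hv)]
          exact hle v hv
      · have hsub : ∀ c, {x | x ∈ A ∧ g x = c} ⊆
            {x | x ∈ insert y A ∧ Function.update g y (g a) x = c} := fun c x hx =>
          ⟨.inr hx.1, by rw [Function.update_of_ne (hne x hx.1), hx.2]⟩
        rintro v (rfl | hv)
        · obtain ⟨b, hb, hbg, p⟩ := hwalk a ha
          refine ⟨b, hb, ?_, ?_⟩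
          · rw [Function.update_of_ne (hne b (hSA hb)), Function.update_self, hbg]
          · rw [Function.update_self, Function.update_self]
            refine (p.mono (hsub _)).append (.edge (hsub _ p.mem_right) ⟨.inl rfl, ?_⟩ hay)
            rw [Function.update_self]
        · obtain ⟨b, hb, hbg, p⟩ := hwalk v hv
          refine ⟨b, hb, ?_, ?_⟩
          · rw [Function.update_of_ne (hne b (hSA hb)), Function.update_of_ne (hne v hv), hbg]
          · rw [Function.update_of_ne (hne v hv), Function.update_of_ne (hne v hv)]
            exact p.mono (hsub _)
      · rintro v (rfl | hv) b hb L p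
        · rw [Function.update_self]
          -- Any walk to the new vertex leaves `A` along an edge that competed in the minimum, so it
          -- is no shorter than the new label.
          obtain ⟨a', y', L₁, L₂, ha', hy', hadj, q₁, q₂, hL⟩ := p.exists_exit (hSA hb) hyA
          have hy'H : y' ∈ H \ A := ⟨(q₂.mem_left).resolve_right fun h => hy' (hSA h), hy'⟩
          have h₁ := hmin' (a', y') ⟨ha', hy'H, hadj⟩
          have h₂ := hmin a' ha' b hb L₁ (q₁.mono Set.inter_subset_left)
          simp only at h₁
          linarith [q₂.nonneg]
        · rw [Function.update_of_ne (hne v hv)]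
          exact hmin v hv b hb L p
    · push Not at hP
      refine ⟨A, g, hSA, hAH, hlab, fun v hv => ?_, fun b hb v hv L p => ?_⟩
      · obtain ⟨b, hb, hbg, p⟩ := hwalk v hv
        exact ⟨b, hb, hbg, _, hle v hv, p⟩
      · obtain ⟨a', y', L₁, L₂, ha', hy', hadj, q₁, q₂, hL⟩ := p.exists_exit (hSA hb) hv.2
        have hy'H : y' ∈ H \ A := ⟨(q₂.mem_left).resolve_right fun h => hy' (hSA h), hy'⟩
        have h₁ := hP (a', y') ⟨ha', hy'H, hadj⟩
        have h₂ := hmin a' ha' b hb L₁ (q₁.mono Set.inter_subset_left)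
        simp only at h₁
        linarith [q₂.nonneg]
  exact main _ S lab (fun _ => 0) rfl subset_rfl Set.subset_union_right (fun _ _ => rfl)
    (fun _ _ => hγ) (fun v hv => ⟨v, hv, rfl, .nil ⟨hv, rfl⟩⟩) fun _ _ _ _ _ p => p.nonneg

end Distance

/-! ### Buffered decompositions into parts with skeletons. -/

section Decomposition

variable {V : Type*} {G : SimpleGraph V} {w : Sym2 V → ℝ≥0} {γ η : ℝ} {h : ℕ}

/-- The connected component of `u` in the graph induced by the unassigned vertices. -/
def comp (G : SimpleGraph V) (w : Sym2 V → ℝ≥0) (f : V → ℕ∞) (u : V) : Set V :=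
  {v | ∃ L, WalkIn G w {x | f x = ⊤} u v L}

/-- The part `X` has a neighbour in `A`. -/
def AdjTo (G : SimpleGraph V) (f : V → ℕ∞) (X : ℕ) (A : Set V) : Prop :=
  ∃ u ∈ A, ∃ v, G.Adj u v ∧ f v = X

/-- `A` lies in a set that neither meets nor sees the part `X`, has no unassigned outer neighbours,
and whose outside is at distance more than `γ` from `A` among the parts from `X` on. -/
def Separated (G : SimpleGraph V) (w : Sym2 V → ℝ≥0) (γ : ℝ) (f : V → ℕ∞) (X : ℕ) (A : Set V) : Prop :=
  ∃ H : Set V, A ⊆ H ∧ (∀ u ∈ H, ∀ v ∉ H, G.Adj u v → f v ≠ ⊤) ∧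
    (∀ u ∈ H, f u ≠ X) ∧ ¬ AdjTo G f X H ∧
    ∀ u ∉ H, ∀ v ∈ A, ∀ L, WalkIn G w {x | (X : ℕ∞) ≤ f x} u v L → γ < L

theorem mem_comp_self {f : V → ℕ∞} {u : V} (hu : f u = ⊤) : u ∈ comp G w f u := ⟨0, .nil hu⟩

theorem eq_top_of_mem_comp {f : V → ℕ∞} {u v : V} (hv : v ∈ comp G w f u) : f v = ⊤ :=
  hv.choose_spec.mem_right

theorem mem_comp_of_adj {f : V → ℕ∞} {u v x : V} (hv : v ∈ comp G w f u) (hvx : G.Adj v x)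
    (hx : f x = ⊤) : x ∈ comp G w f u := by
  obtain ⟨L, p⟩ := hv
  exact ⟨_, p.append (.edge p.mem_right hx hvx)⟩

theorem comp_eq_of_mem {f : V → ℕ∞} {u v : V} (hv : v ∈ comp G w f u) :
    comp G w f v = comp G w f u := by
  obtain ⟨L, p⟩ := hv
  ext x
  exact ⟨fun ⟨M, q⟩ => ⟨_, p.append q⟩, fun ⟨M, q⟩ => ⟨_, p.symm.append q⟩⟩

theorem comp_subset {f : V → ℕ∞} {u : V} {D : Set V} (hu : u ∈ D)
    (hD : ∀ x ∈ D, ∀ y ∉ D, G.Adj x y → f y ≠ ⊤) : comp G w f u ⊆ D := by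
  rintro v ⟨L, p⟩
  exact (p.inter_of_closed hu fun x hx y hxy hy => by
    by_contra hyD
    exact hD x hx y hyD hxy hy).mem_right.2

theorem exists_walkIn_comp {f : V → ℕ∞} {u v : V} (hv : v ∈ comp G w f u) :
    ∃ L, WalkIn G w (comp G w f u) u v L := by
  obtain ⟨L, p⟩ := hv
  exact ⟨L, (p.inter_of_closed (A := comp G w f u) (mem_comp_self p.mem_left)
    fun x hx y hxy hy => mem_comp_of_adj hx hxy hy).mono Set.inter_subset_right⟩

theorem AdjTo.mono {f : V → ℕ∞} {X : ℕ} {A B : Set V} (hA : AdjTo G f X A) (hAB : A ⊆ B) :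
    AdjTo G f X B := by
  obtain ⟨u, hu, H⟩ := hA
  exact ⟨u, hAB hu, H⟩

theorem Separated.anti {f : V → ℕ∞} {X : ℕ} {A B : Set V} (hB : Separated G w γ f X B) (hAB : A ⊆ B) :
    Separated G w γ f X A := by
  obtain ⟨H, h₁, h₂, h₃, h₄, h₅⟩ := hB
  exact ⟨H, hAB.trans h₁, h₂, h₃, h₄, fun u hu v hv => h₅ u hu v (hAB hv)⟩

theorem Separated.not_adjTo {f : V → ℕ∞} {X : ℕ} {A : Set V} (hA : Separated G w γ f X A) :
    ¬ AdjTo G f X A := by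
  obtain ⟨H, h₁, h₂, h₃, h₄, h₅⟩ := hA
  exact fun h => h₄ (h.mono h₁)

/-- `f'` assigns more vertices than `f`; those that it adds to one of the first `n` parts lie in
components seen by that part. -/
def Extends (G : SimpleGraph V) (w : Sym2 V → ℝ≥0) (n : ℕ) (f f' : V → ℕ∞) : Prop :=
  ∀ v, f' v = f v ∨ f v = ⊤ ∧ ∃ Y : ℕ, f' v = Y ∧ (n ≤ Y ∨ AdjTo G f Y (comp G w f v))

namespace Extends

variable {f f' : V → ℕ∞} {n : ℕ} {u v : V}

theorem le (hf : Extends G w n f f') (v : V) : f' v ≤ f v := by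
  rcases hf v with h | ⟨h, -⟩
  · exact h.le
  · rw [h]; exact le_top

theorem eq_of_ne_top (hf : Extends G w n f f') (hv : f v ≠ ⊤) : f' v = f v :=
  (hf v).resolve_right fun h => hv h.1

theorem eq_top (hf : Extends G w n f f') (hv : f' v = ⊤) : f v = ⊤ :=
  top_le_iff.1 (hv ▸ hf.le v)

theorem eq_coe (hf : Extends G w n f f') {X : ℕ} (hv : f v = X) : f' v = X := by
  rw [hf.eq_of_ne_top (hv ▸ ENat.natCast_ne_top X), hv]

theorem comp_subset (hf : Extends G w n f f') : comp G w f' u ⊆ comp G w f u := by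
  rintro v ⟨L, p⟩
  exact ⟨L, p.mono fun x hx => hf.eq_top hx⟩

/-- The same witness `H` survives: the component of an unassigned vertex of `H` stays in `H`, where
it does not see `X`, so `X` never enters `H`. Lowering `f` can only destroy walks among the parts
from `X` on. -/
theorem sep (hf : Extends G w n f f') {X : ℕ} (hX : X < n) {A : Set V}
    (hA : Separated G w γ f X A) : Separated G w γ f' X A := by
  obtain ⟨H, h₁, h₂, h₃, h₄, h₅⟩ := hA
  have h₆ : ∀ u ∈ H, f' u ≠ X := by
    intro u hu hX'
    rcases hf u with h | ⟨h, Y, hY, hY'⟩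
    · exact h₃ u hu (h ▸ hX')
    · obtain rfl : Y = X := by rw [hY] at hX'; exact_mod_cast hX'
      rcases hY' with hY' | hY'
      · omega
      · exact h₄ (hY'.mono (_root_.comp_subset hu h₂))
  refine ⟨H, h₁, fun u hu v hv huv hv' => h₂ u hu v hv huv (hf.eq_top hv'), h₆, ?_, ?_⟩
  · rintro ⟨u, hu, v, huv, hv⟩
    by_cases hvH : v ∈ H
    · exact h₆ v hvH hv
    · exact h₄ ⟨u, hu, v, huv, hf.eq_of_ne_top (h₂ u hu v hvH huv) ▸ hv⟩
  · exact fun u hu v hv L p => h₅ u hu v hv L (p.mono fun x hx => le_trans hx (hf.le x))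

end Extends

/-- A partial partition of the vertex set into `n` parts with skeletons: `f` assigns vertices to
parts (`⊤` for unassigned vertices), `back i` are the earlier parts that saw the component `dom i`
in which part `i` was created, and `skel i s` are nearly shortest paths of `dom i` from `root i`. -/
structure PartialDecomp (G : SimpleGraph V) (w : Sym2 V → ℝ≥0) (γ η : ℝ) (h : ℕ) where
  n : ℕ
  f : V → ℕ∞
  back : ℕ → Finset ℕ
  dom : ℕ → Set V
  root : ℕ → V
  skel : ℕ → ℕ → Set V
  f_lt : ∀ v, f v = ⊤ ∨ f v < n
  back_lt : ∀ i, ∀ j ∈ back i, j < i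
  back_of_le : ∀ i, n ≤ i → back i = ∅
  card_back : ∀ i, (back i).card + 2 ≤ h
  chordal : ∀ i, ∀ j ∈ back i, ∀ k ∈ back i, j < k → j ∈ back k
  mem_dom : ∀ v (i : ℕ), f v = i → v ∈ dom i
  connected : ∀ v (i : ℕ), f v = i → f (root i) = i ∧ ∃ L, WalkIn G w {x | f x = i} (root i) v L
  dom_boundary : ∀ i < n, ∀ u ∈ dom i, ∀ v ∉ dom i, G.Adj u v → f v < i
  adj_of_mem_back : ∀ i < n, ∀ j ∈ back i, ∃ u v, f u = j ∧ f v = i ∧ G.Adj u v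
  sep : ∀ i < n, ∀ j < i, j ∉ back i → Separated G w γ f j (dom i)
  dom_connected : ∀ i < n, ∀ v ∈ dom i, ∃ L, WalkIn G w (dom i) (root i) v L
  skel_dom : ∀ i < n, ∀ s ∈ insert i (back i), skel i s ⊆ dom i
  skel_geodesic : ∀ i < n, ∀ s ∈ insert i (back i), ∀ q ∈ skel i s, ∀ q' ∈ skel i s,
    ∃ L, WalkIn G w Set.univ q q' L ∧
      L ≤ |distIn G w (dom i) (root i) q - distIn G w (dom i) (root i) q'| + η
  radius : ∀ v (i : ℕ), f v = i → ∃ s ∈ insert i (back i), ∃ q ∈ skel i s,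
    ∃ L ≤ γ * (back i).card, WalkIn G w (dom i) v q L
  radius_boundary : ∀ u v (i : ℕ), f v = i → f u = ⊤ → G.Adj v u → ∃ s ∈ insert i (back i),
    ∃ q ∈ skel i s, ∃ L, ∃ S ⊆ back i, (∀ j ∈ S, Separated G w γ f j (comp G w f u)) ∧
      L ≤ γ * S.card ∧ WalkIn G w (dom i) v q L

namespace PartialDecomp

variable (P : PartialDecomp G w γ η h)

theorem lt_n {v : V} {i : ℕ} (hv : P.f v = i) : i < P.n := by
  rcases P.f_lt v with h | h
  · rw [hv] at h; exact absurd h (ENat.natCast_ne_top i)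
  · rw [hv] at h; exact_mod_cast h

theorem dom_boundary_ne_top {i : ℕ} (hi : i < P.n) : ∀ u ∈ P.dom i, ∀ v ∉ P.dom i, G.Adj u v →
    P.f v ≠ ⊤ :=
  fun u hu v hv huv => ((P.dom_boundary i hi u hu v hv huv).trans_le le_top).ne

theorem comp_subset_dom {u v : V} {i : ℕ} (hv : P.f v = i) (hu : P.f u = ⊤)
    (huv : G.Adj v u) : comp G w P.f u ⊆ P.dom i := by
  refine comp_subset ?_ (P.dom_boundary_ne_top (P.lt_n hv))
  by_contra hu'
  exact P.dom_boundary_ne_top (P.lt_n hv) v (P.mem_dom v i hv) u hu' huv hu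

theorem comp_subset_dom_of_adjTo {u : V} {i : ℕ} (hi : AdjTo G P.f i (comp G w P.f u)) :
    comp G w P.f u ⊆ P.dom i := by
  obtain ⟨a, ha, b, hab, hb⟩ := hi
  rw [← comp_eq_of_mem ha]
  exact P.comp_subset_dom hb (eq_top_of_mem_comp ha) hab.symm

/-- Extending the parts into a component that got too close to a part it does not see. -/
theorem exists_grow [Finite V] (hγ : 0 ≤ γ) {X : ℕ} {u₀ : V} (hX : X < P.n)
    (hadj : ¬ AdjTo G P.f X (comp G w P.f u₀)) (hsep : ¬ Separated G w γ P.f X (comp G w P.f u₀)) :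
    ∃ P' : PartialDecomp G w γ η h,
      {v | P'.f v = ⊤}.ncard < {v | P.f v = ⊤}.ncard := by
  classical
  set H := comp G w P.f u₀ with hH
  have hHtop : ∀ v ∈ H, P.f v = ⊤ := fun v hv => eq_top_of_mem_comp hv
  have hHclosed : ∀ u ∈ H, ∀ v ∉ H, G.Adj u v → P.f v ≠ ⊤ := fun u hu v hv huv h =>
    hv (mem_comp_of_adj hu huv h)
  -- The sources of growth are the boundary vertices that a walk avoiding the parts before `X` can
  -- use to enter `H`. None lies in `X`, which `H` does not see.
  let S : Set V := {b | P.f b ≠ ⊤ ∧ (X : ℕ∞) ≤ P.f b ∧ ∃ a ∈ H, G.Adj b a}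
  obtain ⟨A, g, hSA, hAH, hlab, hreach, hfar⟩ :=
    exists_voronoi (G := G) (w := w) H S P.f hγ
  have hS : ∀ b ∈ S, ∃ Y : ℕ, P.f b = Y ∧ X < Y := by
    rintro b ⟨hb, hXb, a, ha, hba⟩
    lift P.f b to ℕ using hb with Y hY
    refine ⟨Y, rfl, lt_of_le_of_ne (by exact_mod_cast hXb) ?_⟩
    rintro rfl
    exact hadj ⟨a, ha, b, hba.symm, hY.symm⟩
  let f' : V → ℕ∞ := fun v => if v ∈ A then g v else P.f v
  have hf'A : ∀ v ∈ A, f' v = g v := fun v hv => if_pos hv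
  have hf'S : ∀ b ∈ S, f' b = P.f b := fun b hb => by rw [hf'A b (hSA hb), hlab b hb]
  have hf'n : ∀ v, v ∉ A ∩ H → f' v = P.f v := by
    intro v hv
    by_cases hvA : v ∈ A
    · exact hf'S v ((hAH hvA).resolve_left fun h => hv ⟨hvA, h⟩)
    · exact if_neg hvA
  -- every new vertex is close to an old vertex of its part
  have hnew : ∀ v ∈ A ∩ H, ∃ Y : ℕ, X < Y ∧ f' v = Y ∧ ∃ b ∈ S, P.f b = Y ∧
      ∃ L ≤ γ, WalkIn G w {x | f' x = Y} b v L := by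
    rintro v ⟨hvA, hvH⟩
    obtain ⟨b, hb, hbg, L, hL, p⟩ := hreach v hvA
    obtain ⟨Y, hY, hXY⟩ := hS b hb
    have hgv : g v = Y := by rw [← hbg, hlab b hb, hY]
    refine ⟨Y, hXY, by rw [hf'A v hvA, hgv], b, hb, hY, L, hL, p.mono ?_⟩
    rintro x ⟨hxA, hx⟩
    change f' x = Y
    rw [hf'A x hxA, hx, hgv]
  have hext : Extends G w P.n P.f f' := by
    intro v
    by_cases hv : v ∈ A ∩ H
    · obtain ⟨Y, hXY, hY, b, hb, hbY, -⟩ := hnew v hv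
      obtain ⟨a, ha, hba⟩ := hb.2.2
      refine .inr ⟨hHtop v hv.2, Y, hY, .inr ⟨a, ?_, b, hba.symm, hbY⟩⟩
      rwa [comp_eq_of_mem hv.2]
    · exact .inl (hf'n v hv)
  have hnotA : ∀ v ∈ H, f' v = ⊤ → v ∈ H \ A := by
    intro v hv htop
    refine ⟨hv, fun hvA => ?_⟩
    obtain ⟨Y, -, hY, -⟩ := hnew v ⟨hvA, hv⟩
    rw [hY] at htop
    exact ENat.natCast_ne_top Y htop
  -- the new part of the component is separated from `X`
  have hsep' : Separated G w γ f' X (H \ A) := by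
    -- The whole old component serves as witness: it absorbs the collar `A ∩ H`, and a walk from
    -- outside must cross that collar.
    refine ⟨H, Set.sdiff_subset, fun u hu v hv huv htop =>
      hHclosed u hu v hv huv (hext.eq_top htop), ?_, ?_, ?_⟩
    · intro u hu hX'
      by_cases huA : u ∈ A
      · obtain ⟨Y, hXY, hY, -⟩ := hnew u ⟨huA, hu⟩
        rw [hY] at hX'
        have : Y = X := by exact_mod_cast hX'
        omega
      · rw [hf'n u fun h => huA h.1, hHtop u hu] at hX'
        exact ENat.natCast_ne_top X hX'.symm
    · rintro ⟨u, hu, v, huv, hv⟩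
      by_cases hvA : v ∈ A ∩ H
      · obtain ⟨Y, hXY, hY, -⟩ := hnew v hvA
        rw [hY] at hv
        have : Y = X := by exact_mod_cast hv
        omega
      · rw [hf'n v hvA] at hv
        exact hadj ⟨u, hu, v, huv, hv⟩
    · intro u hu v hv L p
      obtain ⟨b, a, L₁, L₂, hb, ha, hba, p₁, p₂, hL⟩ := p.exists_entry hu hv.1
      have hbX : (X : ℕ∞) ≤ f' b := p₁.mem_right
      have hbS : b ∈ S := by
        refine ⟨hHclosed a ha b hb hba.symm, ?_, a, ha, hba⟩
        rwa [← hf'n b fun h => hb h.2]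
      have := hfar b hbS v hv _
        (.cons (.inr hbS) hba (p₂.mono fun x hx => .inl hx.2))
      linarith [p₁.nonneg]
  have hdom : ∀ v (i : ℕ), f' v = i → v ∈ P.dom i := by
    intro v i hv
    by_cases hvA : v ∈ A ∩ H
    · obtain ⟨Y, -, hY, b, hb, hbY, -⟩ := hnew v hvA
      obtain rfl : Y = i := by rw [hY] at hv; exact_mod_cast hv
      obtain ⟨a, ha, hba⟩ := hb.2.2
      have := P.comp_subset_dom hbY (hHtop a ha) hba
      rw [comp_eq_of_mem ha] at this
      exact this hvA.2
    · exact P.mem_dom v i (hf'n v hvA ▸ hv)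
  -- the radius of the new vertices
  have hrad : ∀ v ∈ A ∩ H, ∀ i : ℕ, f' v = i → ∃ s ∈ insert i (P.back i), ∃ q ∈ P.skel i s,
      ∃ L, ∃ T ⊆ P.back i, (∀ j ∈ T, Separated G w γ f' j (H \ A)) ∧
        L ≤ γ * T.card ∧ WalkIn G w (P.dom i) v q L := by
    intro v hvA i hv
    obtain ⟨Y, hXY, hY, b, hb, hbY, M, hM, p⟩ := hnew v hvA
    obtain rfl : Y = i := by rw [hY] at hv; exact_mod_cast hv
    obtain ⟨a, ha, hba⟩ := hb.2.2
    obtain ⟨s, hs, q, hq, L, T, hT, hTsep, hL, hwalk⟩ :=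
      P.radius_boundary a b Y hbY (hHtop a ha) hba
    rw [comp_eq_of_mem ha] at hTsep
    have hYn := P.lt_n hbY
    -- The extra radius `γ` is charged to `X`: a back part of `Y` from which the component was not
    -- separated before the growth, but is afterwards.
    have hXT : X ∉ T := fun hXT => hsep (hTsep X hXT)
    have hXback : X ∈ P.back Y := by
      by_contra hXback
      have hsub := P.comp_subset_dom hbY (hHtop a ha) hba
      rw [comp_eq_of_mem ha] at hsub
      exact hsep ((P.sep Y hYn X hXY hXback).anti hsub)
    refine ⟨s, hs, q, hq, M + L, insert X T, Finset.insert_subset hXback hT, ?_, ?_,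
      ((p.mono fun x hx => hdom x Y hx).symm).append hwalk⟩
    · intro j hj
      rcases Finset.mem_insert.1 hj with rfl | hj
      · exact hsep'
      · exact (hext.sep ((P.back_lt Y j (hT hj)).trans hYn) (hTsep j hj)).anti Set.sdiff_subset
    · rw [Finset.card_insert_of_notMem hXT]
      push_cast
      linarith
  refine ⟨{ P with
    f := f'
    f_lt := ?_
    mem_dom := hdom
    connected := ?_
    dom_boundary := ?_
    adj_of_mem_back := ?_
    sep := fun i hi j hj hji => hext.sep (hj.trans hi) (P.sep i hi j hj hji)
    radius := ?_
    radius_boundary := ?_ }, ?_⟩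
  · intro v
    by_cases hv : v ∈ A ∩ H
    · obtain ⟨Y, -, hY, b, hb, hbY, -⟩ := hnew v hv
      right
      rw [hY]
      exact_mod_cast P.lt_n hbY
    · rw [hf'n v hv]
      exact P.f_lt v
  · intro v i hv
    by_cases hvA : v ∈ A ∩ H
    · obtain ⟨Y, -, hY, b, hb, hbY, M, hM, p⟩ := hnew v hvA
      obtain rfl : Y = i := by rw [hY] at hv; exact_mod_cast hv
      obtain ⟨hr, L, q⟩ := P.connected b Y hbY
      exact ⟨hext.eq_coe hr, _, (q.mono fun x hx => hext.eq_coe hx).append p⟩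
    · rw [hf'n v hvA] at hv
      obtain ⟨hr, L, q⟩ := P.connected v i hv
      exact ⟨hext.eq_coe hr, _, q.mono fun x hx => hext.eq_coe hx⟩
  · intro i hi u hu v hv huv
    exact (hext.le v).trans_lt (P.dom_boundary i hi u hu v hv huv)
  · intro i hi j hj
    obtain ⟨u, v, hu, hv, huv⟩ := P.adj_of_mem_back i hi j hj
    exact ⟨u, v, hext.eq_coe hu, hext.eq_coe hv, huv⟩
  · intro v i hv
    by_cases hvA : v ∈ A ∩ H
    · obtain ⟨s, hs, q, hq, L, T, hT, -, hL, p⟩ := hrad v hvA i hv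
      refine ⟨s, hs, q, hq, L, hL.trans ?_, p⟩
      gcongr
    · exact P.radius v i (hf'n v hvA ▸ hv)
  · intro u v i hv hu hvu
    by_cases hvA : v ∈ A ∩ H
    · obtain ⟨s, hs, q, hq, L, T, hT, hTsep, hL, p⟩ := hrad v hvA i hv
      refine ⟨s, hs, q, hq, L, T, hT, fun j hj => (hTsep j hj).anti ?_, hL, p⟩
      intro x hx
      have huH : u ∈ H := mem_comp_of_adj hvA.2 hvu (hext.eq_top hu)
      have hxH : x ∈ H := by rw [hH, ← comp_eq_of_mem huH]; exact hext.comp_subset hx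
      exact hnotA x hxH (eq_top_of_mem_comp hx)
    · rw [hf'n v hvA] at hv
      obtain ⟨s, hs, q, hq, L, T, hT, hTsep, hL, p⟩ :=
        P.radius_boundary u v i hv (hext.eq_top hu) hvu
      exact ⟨s, hs, q, hq, L, T, hT, fun j hj => (hext.sep ((P.back_lt i j (hT hj)).trans
        (P.lt_n hv)) (hTsep j hj)).anti hext.comp_subset, hL, p⟩
  -- If nothing were assigned, `A` would miss `H`, and `hsep'` would already separate the component
  -- from `X`.
  · refine Set.ncard_lt_ncard ⟨fun v hv => hext.eq_top hv, fun hsub => hsep ?_⟩ (Set.toFinite _)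
    have htop : ∀ v ∈ H, v ∈ H \ A := fun v hv => hnotA v hv (hsub (hHtop v hv))
    have hff' : f' = P.f := by
      funext v
      exact hf'n v fun hv => (htop v hv.2).2 hv.1
    rw [hff'] at hsep'
    exact hsep'.anti htop

/-- If a component sees `A`, then the parts in `A` are pairwise adjacent and not too many. -/
theorem card_add_two_le (hG : CliqueMinorFree G h) {u₀ : V} (hu₀ : P.f u₀ = ⊤) {A : Finset ℕ}
    (hA : ∀ i ∈ A, AdjTo G P.f i (comp G w P.f u₀))
    (hback : ∀ j ∈ A, ∀ i ∈ A, j < i → j ∈ P.back i) : A.card + 2 ≤ h := by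
  classical
  by_contra hcard
  have hlt : ∀ i ∈ A, i < P.n := fun i hi => by
    obtain ⟨a, -, b, -, hb⟩ := hA i hi
    exact P.lt_n hb
  have hn : P.n ∉ A := fun hn => (hlt _ hn).false
  -- The component, labelled `P.n`, is one more branch set, so `h - 1` parts in `A` would already
  -- give a `K_h` minor.
  obtain ⟨e⟩ : Nonempty (Fin h ↪ (insert P.n A : Finset ℕ)) := by
    apply Function.Embedding.nonempty_of_card_le
    rw [Fintype.card_coe, Finset.card_insert_of_notMem hn, Fintype.card_fin]
    omega
  set H := comp G w P.f u₀ with hH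
  let B : ℕ → Set V := fun i => if i = P.n then H else {v | P.f v = i}
  have hBn : B P.n = H := if_pos rfl
  have hBA : ∀ i ∈ A, B i = {v | P.f v = i} := fun i hi => if_neg (hlt i hi).ne
  have hcon : ∀ (D : Set V) (a : V), a ∈ D → (∀ v ∈ D, ∃ L, WalkIn G w D a v L) →
      (G.induce D).Connected := by
    intro D a ha hD
    rw [SimpleGraph.connected_iff_exists_forall_reachable]
    refine ⟨⟨a, ha⟩, fun ⟨v, hv⟩ => ?_⟩
    obtain ⟨L, p⟩ := hD v hv
    clear hD
    induction p with
    | nil => exact SimpleGraph.Reachable.refl _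
    | @cons a b v L ha' hab p ih =>
      have hadj : (G.induce D).Adj ⟨a, ha⟩ ⟨b, p.mem_left⟩ := hab
      exact hadj.reachable.trans (ih p.mem_left hv)
  have hadj : ∀ i ∈ insert P.n A, ∀ j ∈ insert P.n A, j < i →
      ∃ u ∈ B j, ∃ v ∈ B i, G.Adj u v := by
    intro i hi j hj hji
    rcases Finset.mem_insert.1 hj with rfl | hj
    · rcases Finset.mem_insert.1 hi with rfl | hi
      · omega
      · exact absurd (hlt i hi) hji.le.not_gt
    rcases Finset.mem_insert.1 hi with rfl | hi
    · obtain ⟨a, ha, b, hab, hb⟩ := hA j hj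
      refine ⟨b, ?_, a, ?_, hab.symm⟩
      · rw [hBA j hj]; exact hb
      · rw [hBn]; exact ha
    · obtain ⟨u, v, hu, hv, huv⟩ := P.adj_of_mem_back i (hlt i hi) j (hback j hj i hi hji)
      refine ⟨u, ?_, v, ?_, huv⟩
      · rw [hBA j hj]; exact hu
      · rw [hBA i hi]; exact hv
  refine hG ⟨fun a => B (e a), fun a => ?_, fun a b hab => ?_, fun a b hab => ?_⟩
  · change (G.induce (B (e a))).Connected
    rcases Finset.mem_insert.1 (e a).2 with ha | ha
    · have hB : B (e a) = H := by rw [ha, hBn]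
      exact hB ▸ hcon H u₀ (mem_comp_self hu₀) fun v hv => exists_walkIn_comp hv
    · obtain ⟨-, -, b, -, hb⟩ := hA _ ha
      exact hBA _ ha ▸ hcon {v | P.f v = (e a : ℕ)} (P.root (e a)) (P.connected b _ hb).1 fun v hv => (P.connected v _ hv).2
  · have hne : (e a : ℕ) ≠ e b := fun h => hab (e.injective (Subtype.ext h))
    have htop : ∀ (i : ℕ) v, P.f v = i → v ∉ H := fun i v hv hvH => by
      rw [eq_top_of_mem_comp hvH] at hv
      exact ENat.natCast_ne_top i hv.symm
    rw [Set.disjoint_left]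
    intro v (hva : v ∈ B (e a)) (hvb : v ∈ B (e b))
    rcases Finset.mem_insert.1 (e a).2 with ha | ha <;>
      rcases Finset.mem_insert.1 (e b).2 with hb | hb
    · exact hne (ha.trans hb.symm)
    · rw [ha, hBn] at hva
      rw [hBA _ hb] at hvb
      exact htop _ v hvb hva
    · rw [hb, hBn] at hvb
      rw [hBA _ ha] at hva
      exact htop _ v hva hvb
    · rw [hBA _ hb] at hvb
      rw [hBA _ ha] at hva
      have h₁ : P.f v = (e a : ℕ) := hva
      have h₂ : P.f v = (e b : ℕ) := hvb
      rw [h₁] at h₂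
      exact hne (by exact_mod_cast h₂)
  · have hne : (e a : ℕ) ≠ e b := fun h => hab (e.injective (Subtype.ext h))
    rcases lt_or_gt_of_ne hne with hlt' | hlt'
    · exact hadj _ (e b).2 _ (e a).2 hlt'
    · obtain ⟨u, hu, v, hv, huv⟩ := hadj _ (e a).2 _ (e b).2 hlt'
      exact ⟨v, hv, u, hu, huv.symm⟩

/-- Creating a new part in a component that is separated from all parts it does not see. -/
theorem exists_create [Finite V] (hγ : 0 ≤ γ) (hη : 0 < η) (hG : CliqueMinorFree G h) {u₀ : V}
    (hu₀ : P.f u₀ = ⊤) (hgood : ∀ X < P.n, AdjTo G P.f X (comp G w P.f u₀) ∨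
      Separated G w γ P.f X (comp G w P.f u₀)) :
    ∃ P' : PartialDecomp G w γ η h,
      {v | P'.f v = ⊤}.ncard < {v | P.f v = ⊤}.ncard := by
  classical
  set H := comp G w P.f u₀ with hH
  have hHtop : ∀ v ∈ H, P.f v = ⊤ := fun v hv => eq_top_of_mem_comp hv
  have hu₀H : u₀ ∈ H := mem_comp_self hu₀
  set A : Finset ℕ := (Finset.range P.n).filter fun X => AdjTo G P.f X H with hAdef
  have hA : ∀ {i}, i ∈ A ↔ i < P.n ∧ AdjTo G P.f i H := by simp [hAdef]
  have hback : ∀ j ∈ A, ∀ i ∈ A, j < i → j ∈ P.back i := by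
    intro j hj i hi hji
    by_contra hnot
    exact ((P.sep i (hA.1 hi).1 j hji hnot).anti
      (P.comp_subset_dom_of_adjTo (hA.1 hi).2)).not_adjTo (hA.1 hj).2
  have hcard := P.card_add_two_le hG hu₀ (fun i hi => (hA.1 hi).2) hback
  have hskel : ∀ s, ∃ Q ⊆ H, u₀ ∈ Q ∧ (s ∈ A → ∃ b ∈ Q, ∃ c, G.Adj b c ∧ P.f c = s) ∧
      (∀ q ∈ Q, ∃ L, WalkIn G w Q u₀ q L) ∧
      ∀ q ∈ Q, ∀ q' ∈ Q, ∃ L, WalkIn G w Q q q' L ∧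
        L ≤ |distIn G w H u₀ q - distIn G w H u₀ q'| + η := by
    intro s
    obtain ⟨b, hb, hbs⟩ : ∃ b ∈ H, s ∈ A → ∃ c, G.Adj b c ∧ P.f c = s := by
      by_cases hs : s ∈ A
      · obtain ⟨b, hb, H'⟩ := (hA.1 hs).2
        exact ⟨b, hb, fun _ => H'⟩
      · exact ⟨u₀, hu₀H, fun h => absurd h hs⟩
    obtain ⟨Q, hQ, ha, hbQ, h₁, h₂⟩ := exists_geodesic (exists_walkIn_comp hb) hη
    exact ⟨Q, hQ, ha, fun hs => ⟨b, hbQ, hbs hs⟩, h₁, h₂⟩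
  choose Q hQH hQu₀ hQA hQcon hQgeo using hskel
  -- The additional label `P.n` keeps `S` nonempty when the component sees no part.
  let S : Set V := {v | ∃ s ∈ insert P.n A, v ∈ Q s}
  have hSH : S ⊆ H := fun v ⟨s, _, hv⟩ => hQH s hv
  have hu₀S : u₀ ∈ S := ⟨P.n, Finset.mem_insert_self _ _, hQu₀ _⟩
  let f' : V → ℕ∞ := fun v => if v ∈ S then (P.n : ℕ∞) else P.f v
  have hf'S : ∀ v ∈ S, f' v = P.n := fun v hv => if_pos hv
  have hf'n : ∀ v ∉ S, f' v = P.f v := fun v hv => if_neg hv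
  have hfn : ∀ v, P.f v ≠ P.n := fun v hv => (P.lt_n hv).false
  have hf'iff : ∀ v, f' v = P.n ↔ v ∈ S := fun v =>
    ⟨fun hv => by_contra fun hvS => hfn v (hf'n v hvS ▸ hv), hf'S v⟩
  have hf'lt : ∀ v (i : ℕ), i ≠ P.n → f' v = i → P.f v = i := by
    intro v i hi hv
    by_cases hvS : v ∈ S
    · rw [hf'S v hvS] at hv
      exact absurd (by exact_mod_cast hv.symm) hi
    · rwa [hf'n v hvS] at hv
  have hext : Extends G w P.n P.f f' := by
    intro v
    by_cases hv : v ∈ S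
    · exact .inr ⟨hHtop v (hSH hv), P.n, hf'S v hv, .inl le_rfl⟩
    · exact .inl (hf'n v hv)
  have hlt : ∀ {i}, i < P.n + 1 → i ≠ P.n → i < P.n := fun h₁ h₂ => by omega
  have hSradius : ∀ v ∈ S, ∃ s ∈ insert P.n A, ∃ q ∈ Q s, WalkIn G w H v q 0 :=
    fun v ⟨s, hs, hv⟩ => ⟨s, hs, v, hv, .nil (hQH s hv)⟩
  refine ⟨{
    n := P.n + 1
    f := f'
    back := fun i => if i = P.n then A else P.back i
    dom := fun i => if i = P.n then H else P.dom i
    root := fun i => if i = P.n then u₀ else P.root i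
    skel := fun i => if i = P.n then Q else P.skel i
    f_lt := ?_
    back_lt := ?_
    back_of_le := ?_
    card_back := ?_
    chordal := ?_
    mem_dom := ?_
    connected := ?_
    dom_boundary := ?_
    adj_of_mem_back := ?_
    sep := ?_
    dom_connected := ?_
    skel_dom := ?_
    skel_geodesic := ?_
    radius := ?_
    radius_boundary := ?_ }, ?_⟩
  · intro v
    by_cases hv : v ∈ S
    · rw [hf'S v hv]
      exact .inr (by exact_mod_cast Nat.lt_succ_self _)
    · rw [hf'n v hv]
      refine (P.f_lt v).imp_right fun h => h.trans (by exact_mod_cast Nat.lt_succ_self _)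
  · intro i j hj
    split_ifs at hj with hi
    · rw [hi]; exact (hA.1 hj).1
    · exact P.back_lt i j hj
  · intro i hi
    rw [if_neg (by omega), P.back_of_le i (by omega)]
  · intro i
    split_ifs with hi
    · exact hcard
    · exact P.card_back i
  · intro i j hj k hk hjk
    split_ifs at hj hk with hi
    · rw [if_neg (hA.1 hk).1.ne]
      exact hback j hj k hk hjk
    · split_ifs with hkn
      · have := P.back_lt i k hk
        rw [P.back_of_le i (by omega)] at hk
        exact absurd hk (Finset.notMem_empty k)
      · exact P.chordal i j hj k hk hjk
  · intro v i hv
    split_ifs with hi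
    · exact hSH ((hf'iff v).1 (hi ▸ hv))
    · exact P.mem_dom v i (hf'lt v i hi hv)
  · intro v i hv
    split_ifs with hi
    · subst hi
      obtain ⟨s, hs, hvs⟩ := (hf'iff v).1 hv
      obtain ⟨L, p⟩ := hQcon s v hvs
      exact ⟨hf'S _ hu₀S, L, p.mono fun x hx => hf'S x ⟨s, hs, hx⟩⟩
    · obtain ⟨hr, L, p⟩ := P.connected v i (hf'lt v i hi hv)
      exact ⟨hext.eq_coe hr, L, p.mono fun x hx => hext.eq_coe hx⟩
  · intro i hi u hu v hv huv
    split_ifs at hu hv with hin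
    · have hvtop : P.f v ≠ ⊤ := fun h => hv (mem_comp_of_adj hu huv h)
      rw [hext.eq_of_ne_top hvtop, hin]
      exact (P.f_lt v).resolve_left hvtop
    · exact (hext.le v).trans_lt (P.dom_boundary i (hlt hi hin) u hu v hv huv)
  · intro i hi j hj
    split_ifs at hj with hin
    · obtain ⟨b, hb, c, hbc, hc⟩ := hQA j hj
      exact ⟨c, b, hext.eq_coe hc, hin ▸ hf'S b ⟨j, Finset.mem_insert_of_mem hj, hb⟩, hbc.symm⟩
    · obtain ⟨u, v, hu, hv, huv⟩ := P.adj_of_mem_back i (hlt hi hin) j hj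
      exact ⟨u, v, hext.eq_coe hu, hext.eq_coe hv, huv⟩
  · intro i hi j hj hji
    split_ifs at hji ⊢ with hin
    · have hjn : j < P.n := hin ▸ hj
      exact hext.sep hjn ((hgood j hjn).resolve_left fun h => hji (hA.2 ⟨hjn, h⟩))
    · exact hext.sep (hj.trans (hlt hi hin)) (P.sep i (hlt hi hin) j hj hji)
  · intro i hi v hv
    split_ifs at hv ⊢ with hin
    · exact exists_walkIn_comp hv
    · exact P.dom_connected i (hlt hi hin) v hv
  · intro i hi s hs
    split_ifs at hs ⊢ with hin
    · exact hQH s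
    · exact P.skel_dom i (hlt hi hin) s hs
  · intro i hi s hs q hq q' hq'
    split_ifs at hs hq hq' ⊢ with hin
    · obtain ⟨L, p, hL⟩ := hQgeo s q hq q' hq'
      exact ⟨L, p.mono (Set.subset_univ _), hL⟩
    · exact P.skel_geodesic i (hlt hi hin) s hs q hq q' hq'
  · intro v i hv
    split_ifs with hin
    · subst hin
      obtain ⟨s, hs, q, hq, p⟩ := hSradius v ((hf'iff v).1 hv)
      exact ⟨s, hs, q, hq, 0, by positivity, p⟩
    · exact P.radius v i (hf'lt v i hin hv)
  · intro u v i hv hu hvu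
    split_ifs with hin
    · subst hin
      obtain ⟨s, hs, q, hq, p⟩ := hSradius v ((hf'iff v).1 hv)
      exact ⟨s, hs, q, hq, 0, ∅, by simp, by simp, by simp, p⟩
    · have hv' := hf'lt v i hin hv
      obtain ⟨s, hs, q, hq, L, T, hT, hTsep, hL, p⟩ :=
        P.radius_boundary u v i hv' (hext.eq_top hu) hvu
      exact ⟨s, hs, q, hq, L, T, hT, fun j hj => (hext.sep ((P.back_lt i j (hT hj)).trans
        (P.lt_n hv')) (hTsep j hj)).anti hext.comp_subset, hL, p⟩
  · refine Set.ncard_lt_ncard ⟨fun v hv => hext.eq_top hv, fun hsub => ?_⟩ (Set.toFinite _)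
    have h₁ : f' u₀ = ⊤ := hsub hu₀
    rw [hf'S u₀ hu₀S] at h₁
    exact ENat.natCast_ne_top _ h₁

/-- Every finite `K_h`-minor-free graph has a decomposition that assigns all vertices. -/
theorem exists_total [Finite V] [Nonempty V] (hγ : 0 ≤ γ) (hη : 0 < η) (hh : 2 ≤ h)
    (hG : CliqueMinorFree G h) :
    ∃ P : PartialDecomp G w γ η h, ∀ v, P.f v ≠ ⊤ := by
  have main : ∀ (m : ℕ) (P : PartialDecomp G w γ η h), {v | P.f v = ⊤}.ncard = m →
      ∃ P : PartialDecomp G w γ η h, ∀ v, P.f v ≠ ⊤ := by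
    intro m
    induction m using Nat.strong_induction_on with
    | _ m ih =>
    intro P hm
    by_cases htop : ∀ v, P.f v ≠ ⊤
    · exact ⟨P, htop⟩
    push Not at htop
    obtain ⟨u₀, hu₀⟩ := htop
    by_cases hgood : ∀ X < P.n, AdjTo G P.f X (comp G w P.f u₀) ∨
        Separated G w γ P.f X (comp G w P.f u₀)
    · obtain ⟨P', hP'⟩ := P.exists_create hγ hη hG hu₀ hgood
      exact ih _ (hm ▸ hP') P' rfl
    · push Not at hgood
      obtain ⟨X, hX, h₁, h₂⟩ := hgood
      obtain ⟨P', hP'⟩ := P.exists_grow hγ hX h₁ h₂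
      exact ih _ (hm ▸ hP') P' rfl
  obtain ⟨v₀⟩ := ‹Nonempty V›
  refine main _
    { n := 0
      f := fun _ => ⊤
      back := fun _ => ∅
      dom := fun _ => ∅
      root := fun _ => v₀
      skel := fun _ _ => ∅
      f_lt := by simp
      back_lt := by simp
      back_of_le := by simp
      card_back := by simpa using hh
      chordal := by simp
      mem_dom := by simp
      connected := by simp
      dom_boundary := by simp
      adj_of_mem_back := by simp
      sep := by simp
      dom_connected := by simp
      skel_dom := by simp
      skel_geodesic := by simp
      radius := by simp
      radius_boundary := by simp } rfl

end PartialDecomp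

end Decomposition

/-! ### Counting vertices reachable by back steps in a chordal ordering. -/

section Hops

/-- The vertices reached from `j` by at most `t` steps to back neighbours. -/
def hops (back : ℕ → Finset ℕ) : ℕ → ℕ → Finset ℕ
  | 0, j => {j}
  | t + 1, j => insert j ((back j).biUnion (hops back t))

variable {back : ℕ → Finset ℕ}

theorem mem_hops_succ {t i j : ℕ} :
    i ∈ hops back (t + 1) j ↔ i = j ∨ ∃ b ∈ back j, i ∈ hops back t b := by
  simp [hops]

theorem self_mem_hops (t j : ℕ) : j ∈ hops back t j := by
  cases t <;> simp [hops]

theorem hops_mono_succ (t : ℕ) : ∀ j, hops back t j ⊆ hops back (t + 1) j := by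
  induction t with
  | zero => intro j; simp [hops]
  | succ t ih =>
    intro j i hi
    rcases mem_hops_succ.1 hi with rfl | ⟨b, hb, hi⟩
    · exact self_mem_hops _ _
    · exact mem_hops_succ.2 (.inr ⟨b, hb, ih b hi⟩)

theorem hops_mono {s t : ℕ} (h : s ≤ t) (j : ℕ) : hops back s j ⊆ hops back t j := by
  induction h with
  | refl => exact subset_rfl
  | step _ ih => exact ih.trans (hops_mono_succ _ j)

theorem mem_hops_of_mem_back {t : ℕ} : ∀ {i j k : ℕ}, k ∈ hops back t j → i ∈ back k →
    i ∈ hops back (t + 1) j := by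
  induction t with
  | zero =>
    intro i j k hk hi
    obtain rfl : k = j := by simpa [hops] using hk
    exact mem_hops_succ.2 (.inr ⟨i, hi, self_mem_hops _ _⟩)
  | succ t ih =>
    intro i j k hk hi
    rcases mem_hops_succ.1 hk with rfl | ⟨b, hb, hk⟩
    · exact mem_hops_succ.2 (.inr ⟨i, hi, self_mem_hops _ _⟩)
    · exact mem_hops_succ.2 (.inr ⟨b, hb, ih hk hi⟩)

/-- `k` is reached from `j` by steps to back neighbours. -/
abbrev Descends (back : ℕ → Finset ℕ) (j k : ℕ) : Prop :=
  Relation.ReflTransGen (fun x y => y ∈ back x) j k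

theorem Descends.le (hlt : ∀ i, ∀ j ∈ back i, j < i) {j k : ℕ} (h : Descends back j k) :
    k ≤ j := by
  induction h with
  | refl => exact le_rfl
  | tail _ h ih => exact (hlt _ _ h).le.trans ih

theorem descends_of_mem_hops {t : ℕ} : ∀ {i j : ℕ}, i ∈ hops back t j → Descends back j i := by
  induction t with
  | zero =>
    intro i j hi
    obtain rfl : i = j := by simpa [hops] using hi
    exact .refl
  | succ t ih =>
    intro i j hi
    rcases mem_hops_succ.1 hi with rfl | ⟨b, hb, hi⟩
    · exact .refl
    · exact .head hb (ih hi)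

/-- Back neighbours of a vertex remain back neighbours along a descending path until the path
passes them. -/
theorem Descends.mem_back_or
    (hch : ∀ i, ∀ j ∈ back i, ∀ k ∈ back i, j < k → j ∈ back k) {j k : ℕ}
    (h : Descends back j k) {c : ℕ} (hc : c ∈ back j) : c ∈ back k ∨ Descends back c k := by
  induction h with
  | refl => exact .inl hc
  | @tail b k _ hk ih =>
    rcases ih with h | h
    · rcases lt_trichotomy c k with hck | rfl | hck
      · exact .inl (hch b c h k hk hck)
      · exact .inr .refl
      · exact .inr (.single (hch b k hk c h hck))
    · exact .inr (h.tail hk)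

/-- Chordality lets a path from `b` be restarted at `a`: a first step to `c < a` is also a back step
from `a`, while for `c > a` the vertex `a` is still a back neighbour of `c`. -/
theorem mem_hops_of_passed (hlt : ∀ i, ∀ j ∈ back i, j < i)
    (hch : ∀ i, ∀ j ∈ back i, ∀ k ∈ back i, j < k → j ∈ back k) {t : ℕ} :
    ∀ {a b i : ℕ}, a ∈ back b → i ∈ hops back t b → i ≤ a → i ∈ hops back t a := by
  induction t with
  | zero =>
    intro a b i ha hi hia
    obtain rfl : i = b := by simpa [hops] using hi
    exact absurd (hlt _ _ ha) (by omega)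
  | succ t ih =>
    intro a b i ha hi hia
    rcases mem_hops_succ.1 hi with rfl | ⟨c, hc, hi⟩
    · exact absurd (hlt _ _ ha) (by omega)
    · rcases lt_trichotomy c a with hca | rfl | hca
      · exact mem_hops_succ.2 (.inr ⟨c, hch b c hc a ha hca, hi⟩)
      · exact hops_mono_succ _ _ hi
      · exact hops_mono_succ _ _ (ih (hch b a ha c hc hca) hi hia)

/-- Pascal's rule. Let `a` be the least back neighbour of `j` that is at least `L`. Targets up to
`a` are reached from `a` in one step fewer. For targets above `a` the back degree effectively drops
by one, since `a` remains a back neighbour of every descendant of `j` above it. -/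
theorem card_hops_filter_le (hlt : ∀ i, ∀ j ∈ back i, j < i)
    (hch : ∀ i, ∀ j ∈ back i, ∀ k ∈ back i, j < k → j ∈ back k) (t k : ℕ) :
    ∀ j L : ℕ, (∀ c, Descends back j c → ((back c).filter (L ≤ ·)).card ≤ k) →
      ((hops back t j).filter (L ≤ ·)).card ≤ (t + k).choose k := by
  induction k generalizing t with
  | zero =>
    intro j L hk
    rw [Nat.choose_zero_right, Finset.card_le_one]
    have : ∀ i ∈ (hops back t j).filter (L ≤ ·), i = j := by
      intro i hi
      obtain ⟨hi, hLi⟩ := Finset.mem_filter.1 hi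
      rcases (descends_of_mem_hops hi).cases_head with rfl | ⟨b, hb, hbi⟩
      · rfl
      · have hmem : b ∈ (back j).filter (L ≤ ·) :=
          Finset.mem_filter.2 ⟨hb, hLi.trans (Descends.le hlt hbi)⟩
        have := hk j .refl
        rw [Nat.le_zero, Finset.card_eq_zero] at this
        simp [this] at hmem
    intro a ha b hb
    rw [this a ha, this b hb]
  | succ k ihk =>
    induction t with
    | zero =>
      intro j L _
      refine (Finset.card_filter_le _ _).trans ?_
      simp [hops]
    | succ t iht =>
      intro j L hk
      by_cases hne : ((back j).filter (L ≤ ·)).Nonempty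
      · obtain ⟨a, ha, hmin⟩ := Finset.exists_min_image _ id hne
        simp only [id] at hmin
        obtain ⟨haj, hLa⟩ := Finset.mem_filter.1 ha
        have hsub : (hops back (t + 1) j).filter (L ≤ ·) ⊆
            (hops back (t + 1) j).filter (a + 1 ≤ ·) ∪ (hops back t a).filter (L ≤ ·) := by
          intro i hi
          obtain ⟨hi, hLi⟩ := Finset.mem_filter.1 hi
          rw [Finset.mem_union, Finset.mem_filter, Finset.mem_filter]
          by_cases hai : a + 1 ≤ i
          · exact .inl ⟨hi, hai⟩
          · refine .inr ⟨?_, hLi⟩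
            rcases mem_hops_succ.1 hi with rfl | ⟨b, hb, hib⟩
            · exact absurd (hlt _ _ haj) (by omega)
            · have hib' := (descends_of_mem_hops hib).le hlt
              have hab := hmin b (Finset.mem_filter.2 ⟨hb, hLi.trans hib'⟩)
              rcases hab.eq_or_lt with rfl | hab
              · exact hib
              · exact mem_hops_of_passed hlt hch (hch j a haj b hb hab) hib (by omega)
        have h₁ := ihk (t + 1) j (a + 1) fun c hc => by
          by_cases hca : c ≤ a
          · rw [Finset.filter_eq_empty_iff.2, Finset.card_empty]
            · exact Nat.zero_le _
            · intro x hx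
              have := hlt c x hx
              omega
          · have hac : a ∈ back c := (hc.mem_back_or hch haj).resolve_right fun h =>
              hca (h.le hlt)
            have hss : (back c).filter (a + 1 ≤ ·) ⊂ (back c).filter (L ≤ ·) := by
              refine ⟨fun x hx => ?_, fun hsub => ?_⟩
              · rw [Finset.mem_filter] at hx ⊢
                exact ⟨hx.1, by omega⟩
              · have := Finset.mem_filter.1 (hsub (Finset.mem_filter.2 ⟨hac, hLa⟩))
                omega
            have := Finset.card_lt_card hss
            have := hk c hc
            omega
        have h₂ := iht a L fun c hc => hk c (.head haj hc)
        calc ((hops back (t + 1) j).filter (L ≤ ·)).card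
            ≤ _ := Finset.card_le_card hsub
          _ ≤ _ := Finset.card_union_le _ _
          _ ≤ (t + 1 + k).choose k + (t + (k + 1)).choose (k + 1) := add_le_add h₁ h₂
          _ = (t + 1 + (k + 1)).choose (k + 1) := by
            rw [show t + 1 + (k + 1) = (t + k + 1) + 1 by ring, Nat.choose_succ_succ,
              show t + 1 + k = t + k + 1 by ring, show t + (k + 1) = t + k + 1 by ring]
      · rw [Finset.not_nonempty_iff_eq_empty] at hne
        have hsub : (hops back (t + 1) j).filter (L ≤ ·) ⊆ {j} := by
          intro i hi
          obtain ⟨hi, hLi⟩ := Finset.mem_filter.1 hi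
          rcases mem_hops_succ.1 hi with rfl | ⟨b, hb, hib⟩
          · exact Finset.mem_singleton_self _
          · have hib' := (descends_of_mem_hops hib).le hlt
            have : b ∈ (back j).filter (L ≤ ·) := Finset.mem_filter.2 ⟨hb, hLi.trans hib'⟩
            rw [hne] at this
            exact absurd this (Finset.notMem_empty b)
        refine (Finset.card_le_card hsub).trans ?_
        rw [Finset.card_singleton]
        exact Nat.choose_pos (by omega)

theorem card_hops_le (hlt : ∀ i, ∀ j ∈ back i, j < i)
    (hch : ∀ i, ∀ j ∈ back i, ∀ k ∈ back i, j < k → j ∈ back k) {k : ℕ}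
    (hk : ∀ i, (back i).card ≤ k) (t j : ℕ) :
    (hops back t j).card ≤ (t + k).choose k := by
  have := card_hops_filter_le hlt hch t k j 0 fun c _ => (Finset.card_filter_le _ _).trans (hk c)
  rwa [Finset.filter_true_of_mem fun _ _ => Nat.zero_le _] at this

end Hops

/-! ### From the decomposition to centers. -/

namespace PartialDecomp

variable {V : Type*} {G : SimpleGraph V} {w : Sym2 V → ℝ≥0} {γ η : ℝ} {h : ℕ}
  (P : PartialDecomp G w γ η h)

/-- The part of a vertex of a decomposition that assigns all vertices. -/
def part (v : V) : ℕ := (P.f v).toNat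

variable {P} (hP : ∀ v, P.f v ≠ ⊤)
include hP

theorem coe_part (v : V) : (P.part v : ℕ∞) = P.f v := ENat.natCast_toNat (hP v)

theorem mem_back_of_adj {u v : V} (huv : G.Adj u v) (hlt : P.part u < P.part v) :
    P.part u ∈ P.back (P.part v) := by
  by_contra hnot
  have hv := (coe_part hP v).symm
  exact (P.sep _ (P.lt_n hv) _ hlt hnot).not_adjTo
    ⟨v, P.mem_dom v _ hv, u, huv.symm, (coe_part hP u).symm⟩

theorem buffer {u v : V} {L : ℝ} (hlt : P.part u < P.part v)
    (hnot : P.part u ∉ P.back (P.part v))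
    (p : WalkIn G w {x | P.part u ≤ P.part x} u v L) : γ < L := by
  have hv := (coe_part hP v).symm
  obtain ⟨H, h₁, h₂, h₃, h₄, h₅⟩ := P.sep _ (P.lt_n hv) _ hlt hnot
  refine h₅ u (fun hu => h₃ u hu (coe_part hP u).symm) v (P.mem_dom v _ hv) L
    (p.mono fun x hx => ?_)
  change (P.part u : ℕ∞) ≤ P.f x
  rw [← coe_part hP x]
  exact_mod_cast hx

/-- A step up from `b` to a later part does no harm: `b`'s part is a back part of the later one, so
along the descent from there it either becomes a back part of `y`'s part, impossible because it is
not smaller, or itself descends to it. -/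
theorem descends_of_walkIn {b y : V} {L : ℝ}
    (p : WalkIn G w {x | P.part y ≤ P.part x} b y L) :
    Descends P.back (P.part b) (P.part y) := by
  generalize hk : P.part y = k at p
  induction p with
  | nil _ => rw [hk]
  | @cons b b' y L hb hbb' p ih =>
    replace ih := ih hk
    rcases lt_trichotomy (P.part b) (P.part b') with hlt | heq | hlt
    · rcases ih.mem_back_or P.chordal (mem_back_of_adj hP hbb' hlt) with h | h
      · exact absurd (P.back_lt _ _ h) (not_lt.2 hb)
      · exact h
    · rw [heq]; exact ih
    · exact .head (mem_back_of_adj hP hbb'.symm hlt) ih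

/-- Weak reachability along short walks is bounded by the number of hops. -/
theorem mem_hops_of_walkIn (m : ℕ) : ∀ {v z : V} {L : ℝ}, L ≤ m * γ → 0 ≤ γ →
    WalkIn G w {x | P.part z ≤ P.part x} v z L →
    P.part z ∈ hops P.back (2 * m + 1) (P.part v) := by
  induction m with
  | zero =>
    intro v z L hL hγ p
    rcases (show P.part z ≤ P.part v from p.mem_left).eq_or_lt with heq | hlt
    · rw [heq]; exact self_mem_hops _ _
    · have : P.part z ∈ P.back (P.part v) := by
        by_contra hnot
        have := buffer hP hlt hnot p.symm
        simp only [CharP.cast_eq_zero, zero_mul] at hL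
        linarith
      exact mem_hops_of_mem_back (self_mem_hops 0 _) this
  | succ m ih =>
    intro v z L hL hγ p
    -- Past the last entry into `A`, the remaining walk starts at a part that is not adjacent to
    -- `z`'s part, so the buffer makes it longer than `γ`. This pays for one unit of `m`.
    let A : Set V := {x | P.part x = P.part z ∨ P.part z ∈ P.back (P.part x)}
    by_cases hv : v ∈ A
    · rcases hv with hv | hv
      · rw [hv]; exact self_mem_hops _ _
      · exact hops_mono (by omega) _ (mem_hops_of_mem_back (self_mem_hops 0 _) hv)
    obtain ⟨b, a, L₁, L₂, hb, ha, hba, p₁, p₂, hsum⟩ := p.exists_entry hv (.inl rfl)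
    have hzb : P.part z < P.part b :=
      lt_of_le_of_ne p₁.mem_right fun h => hb (.inl h.symm)
    have hbz : P.part z ∉ P.back (P.part b) := fun h => hb (.inr h)
    have p₃ := WalkIn.cons (p₁.mem_right) hba (p₂.mono Set.inter_subset_left)
    have hL₂ := buffer hP hzb hbz p₃.symm
    have hL₁ : L₁ ≤ m * γ := by
      push_cast at hL
      linarith
    obtain ⟨y, M₁, M₂, q₁, q₂, hM⟩ := p₁.exists_min P.part
    have hy := ih (by linarith [q₂.nonneg]) hγ (q₁.mono fun x hx => hx.2)
    have hzy : P.part z ≤ P.part y := q₁.mem_right.1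
    have hdesc := descends_of_walkIn hP (q₂.symm.mono fun x hx => hx.2)
    have hab : P.part a < P.part b := by
      rcases lt_trichotomy (P.part a) (P.part b) with h | h | h
      · exact h
      · exact absurd (show b ∈ A by simpa [A, h] using ha) hb
      · have hba' := mem_back_of_adj hP hba h
        rcases ha with ha | ha
        · omega
        · exact absurd (P.chordal _ _ ha _ hba' hzb) hbz
    have hab' := mem_back_of_adj hP hba.symm hab
    have hza : P.part z ∈ P.back (P.part a) := ha.resolve_left fun h => hbz (h ▸ hab')
    have hgoal : P.part y ∈ hops P.back (2 * m + 1) (P.part v) := hy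
    -- From the earliest part `y` before the entry, two more hops suffice, through `a`. If the
    -- descent has already passed `a`, one hop or none is enough.
    rcases hdesc.mem_back_or P.chordal hab' with h | h
    · exact mem_hops_of_mem_back (mem_hops_of_mem_back hgoal h) hza
    · rcases h.mem_back_or P.chordal hza with h' | h'
      · exact hops_mono_succ _ _ (mem_hops_of_mem_back hgoal h')
      · rw [le_antisymm hzy (h'.le P.back_lt)]
        exact hops_mono (by omega) _ hgoal

/-- Pairs of vertices joined by a short walk have a common center near that walk, and every vertex
has few centers. -/
theorem exists_centers {δ R : ℝ} (hδ : 0 < δ) (hγ : 0 ≤ γ) {m : ℕ} (hR : R ≤ m * γ)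
    {N : ℕ} (hN : 2 * (R + γ * h) / δ + 2 ≤ N) :
    ∃ W : V → Finset V,
      (∀ v, (W v).card ≤ (2 * m + 1 + (h - 2)).choose (h - 2) * ((h - 1) * N)) ∧
      ∀ u v L, L ≤ R → WalkIn G w Set.univ u v L → ∃ c ∈ W u, c ∈ W v ∧ ∃ L₁ L₂,
        WalkIn G w Set.univ u c L₁ ∧ WalkIn G w Set.univ v c L₂ ∧
        L₁ + L₂ ≤ L + 2 * (γ * h + δ + η) := by
  classical
  rcases isEmpty_or_nonempty V with hV | hV
  · exact ⟨fun _ => ∅, by simp, fun u => hV.elim u⟩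
  let pos : ℕ → V → ℝ := fun i v => distIn G w (P.dom i) (P.root i) v
  let S : ℝ := R + γ * h
  -- One representative for each skeleton path and each interval of length `δ` of distances from the
  -- root. It does not depend on the end of the walk, so both ends find the same one.
  let center : ℕ → ℕ → ℤ → V := fun i s k =>
    Classical.epsilon fun q => q ∈ P.skel i s ∧ ⌊pos i q / δ⌋ = k
  let W : V → Finset V := fun v => (hops P.back (2 * m + 1) (P.part v)).biUnion fun i =>
    (insert i (P.back i)).biUnion fun s =>
      (Finset.Icc ⌊(pos i v - S) / δ⌋ ⌊(pos i v + S) / δ⌋).image (center i s)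
  have hcard : ∀ i, (P.back i).card ≤ h - 2 := fun i => by have := P.card_back i; omega
  refine ⟨W, fun v => ?_, fun u v L hL p => ?_⟩
  · refine (Finset.card_biUnion_le_card_mul _ _ ((h - 1) * N) fun i _ => ?_).trans
      (Nat.mul_le_mul_right _ (card_hops_le P.back_lt P.chordal hcard _ _))
    refine (Finset.card_biUnion_le_card_mul _ _ N fun s _ => ?_).trans
      (Nat.mul_le_mul_right _ ?_)
    · refine Finset.card_image_le.trans ?_
      rw [Int.card_Icc, Int.toNat_le, ← Int.cast_le (R := ℝ)]
      push_cast
      have h₁ := Int.floor_le ((pos i v + S) / δ)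
      have h₂ := Int.lt_floor_add_one ((pos i v - S) / δ)
      have h₃ : (pos i v + S) / δ - (pos i v - S) / δ = 2 * (R + γ * h) / δ := by
        simp only [S]; ring
      linarith
    · refine (Finset.card_insert_le _ _).trans ?_
      have := P.card_back i
      omega
  obtain ⟨z, L₁, L₂, p₁, p₂, hsum⟩ := p.exists_min P.part
  replace p₁ := p₁.mono (D' := {x | P.part z ≤ P.part x}) fun x hx => hx.2
  replace p₂ := (p₂.mono (D' := {x | P.part z ≤ P.part x}) fun x hx => hx.2).symm
  have hz := (coe_part hP z).symm
  set i := P.part z with hi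
  have hin := P.lt_n hz
  obtain ⟨s, hs, q, hq, M, hM, r⟩ := P.radius z i hz
  have hMh : M ≤ γ * h := hM.trans (by
    have := P.card_back i
    gcongr
    omega)
  have hclosed : ∀ x ∈ P.dom i, ∀ y, G.Adj x y → y ∈ {x | i ≤ P.part x} → y ∈ P.dom i := by
    intro x hx y hxy hy
    by_contra hyD
    have := P.dom_boundary i hin x hx y hyD hxy
    rw [← coe_part hP y] at this
    exact absurd (show P.part y < i by exact_mod_cast this) (not_lt.2 hy)
  have hconn := P.dom_connected i hin
  set c := center i s ⌊pos i q / δ⌋ with hc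
  obtain ⟨hcQ, hcpos⟩ : c ∈ P.skel i s ∧ ⌊pos i c / δ⌋ = ⌊pos i q / δ⌋ :=
    Classical.epsilon_spec (p := fun x => x ∈ P.skel i s ∧ ⌊pos i x / δ⌋ = ⌊pos i q / δ⌋)
      ⟨q, hq, rfl⟩
  obtain ⟨K, rK, hK⟩ := P.skel_geodesic i hin s hs q hq c hcQ
  have hKδ : K ≤ δ + η := by
    have h₁ : |pos i q / δ - pos i c / δ| < 1 := Int.abs_sub_lt_one_of_floor_eq_floor hcpos.symm
    rw [← sub_div, abs_div, abs_of_pos hδ, div_lt_one hδ] at h₁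
    linarith
  have key : ∀ {x M'}, WalkIn G w {x | i ≤ P.part x} x z M' → M' ≤ R → c ∈ W x ∧
      WalkIn G w Set.univ x c (M' + (M + K)) := by
    intro x M' px hM'
    -- The domain of part `i` can only be left into earlier parts, so the walk stays in it and
    -- controls the distances from the root.
    have hx := (px.symm.inter_of_closed (P.mem_dom z i hz) hclosed).symm.mono
      Set.inter_subset_right
    have hdist : |pos i x - pos i q| ≤ M' + M :=
      abs_distIn_sub_le (hconn x hx.mem_left) (hx.append r)
    have hdS : |pos i x - pos i q| ≤ S := hdist.trans (add_le_add hM' hMh)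
    rw [abs_le] at hdS
    refine ⟨?_, (px.mono (Set.subset_univ _)).append
      ((r.mono (Set.subset_univ _)).append rK)⟩
    refine Finset.mem_biUnion.2 ⟨i, mem_hops_of_walkIn hP m (hM'.trans hR) hγ px,
      Finset.mem_biUnion.2 ⟨s, hs, Finset.mem_image.2 ⟨_, Finset.mem_Icc.2 ⟨?_, ?_⟩, rfl⟩⟩⟩
    · exact Int.floor_le_floor (by gcongr; linarith)
    · exact Int.floor_le_floor (by gcongr; linarith)
  obtain ⟨hcu, pu⟩ := key p₁ (by linarith [p₂.nonneg])
  obtain ⟨hcv, pv⟩ := key p₂ (by linarith [p₁.nonneg])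
  exact ⟨c, hcu, hcv, _, _, pu, pv, by linarith⟩

end PartialDecomp

/-! ### The metric with weights in `[0, ∞]`, and discarding edges of infinite weight. -/

section GraphMetric

variable {V : Type*} {G : SimpleGraph V} {w : Sym2 V → ℝ≥0∞}

theorem walkLength_cons {u v z : V} (huv : G.Adj u v) (q : G.Walk v z) :
    walkLength w (.cons huv q) = w s(u, v) + walkLength w q := by
  simp [walkLength]

theorem graphMetric_self (u : V) : graphMetric G w u u = 0 :=
  le_antisymm (iInf_le_of_le .nil (by simp [walkLength])) zero_le

theorem graphMetric_comm (u v : V) : graphMetric G w u v = graphMetric G w v u := by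
  have : ∀ u v, graphMetric G w u v ≤ graphMetric G w v u := fun u v =>
    le_iInf fun q => iInf_le_of_le q.reverse (by simp [walkLength, List.sum_reverse])
  exact le_antisymm (this u v) (this v u)

theorem graphMetric_triangle (u v z : V) :
    graphMetric G w u z ≤ graphMetric G w u v + graphMetric G w v z := by
  simp only [graphMetric, ENNReal.iInf_add, ENNReal.add_iInf]
  exact le_iInf fun q => le_iInf fun q' => iInf_le_of_le (q'.append q) (by simp [walkLength])

/-- The subgraph of the edges of finite weight. -/
def finiteWeightGraph (G : SimpleGraph V) (w : Sym2 V → ℝ≥0∞) : SimpleGraph V where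
  Adj u v := G.Adj u v ∧ w s(u, v) ≠ ∞
  symm := ⟨fun u v h => ⟨h.1.symm, by rw [Sym2.eq_swap]; exact h.2⟩⟩
  loopless := ⟨fun u h => h.1.ne rfl⟩

theorem finiteWeightGraph_le : finiteWeightGraph G w ≤ G := fun _ _ h => h.1

theorem exists_walkIn_of_walk {u v : V} (q : G.Walk u v) (hq : walkLength w q ≠ ∞) :
    ∃ L, WalkIn (finiteWeightGraph G w) (fun e => (w e).toNNReal) Set.univ u v L ∧
      ENNReal.ofReal L = walkLength w q := by
  induction q with
  | nil => exact ⟨0, .nil trivial, by simp [walkLength]⟩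
  | @cons u v z huv q ih =>
    rw [walkLength_cons, ENNReal.add_ne_top] at hq
    obtain ⟨L, p, hL⟩ := ih hq.2
    refine ⟨_, .cons trivial ⟨huv, hq.1⟩ p, ?_⟩
    rw [walkLength_cons, ENNReal.ofReal_add (NNReal.coe_nonneg _) p.nonneg, hL,
      ENNReal.ofReal_coe_nnreal, ENNReal.coe_toNNReal hq.1]

theorem exists_walkIn_of_graphMetric_lt {u v : V} {a : ℝ}
    (h : graphMetric G w u v < ENNReal.ofReal a) :
    ∃ L ≤ a, WalkIn (finiteWeightGraph G w) (fun e => (w e).toNNReal) Set.univ u v L := by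
  obtain ⟨q, hq⟩ := iInf_lt_iff.1 h
  obtain ⟨L, p, hL⟩ := exists_walkIn_of_walk q hq.ne_top
  refine ⟨L, ?_, p⟩
  rw [← hL] at hq
  exact ((ENNReal.ofReal_lt_ofReal_iff_of_nonneg p.nonneg).1 hq).le

theorem graphMetric_le_of_walkIn {u v : V} {L : ℝ} {D : Set V}
    (p : WalkIn (finiteWeightGraph G w) (fun e => (w e).toNNReal) D u v L) :
    graphMetric G w u v ≤ ENNReal.ofReal L := by
  have : ∃ q : G.Walk u v, walkLength w q = ENNReal.ofReal L := by
    induction p with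
    | nil => exact ⟨.nil, by simp [walkLength]⟩
    | @cons u v z L _ huv p ih =>
      obtain ⟨q, hq⟩ := ih
      refine ⟨.cons huv.1 q, ?_⟩
      rw [walkLength_cons, hq, ENNReal.ofReal_add (NNReal.coe_nonneg _) p.nonneg,
        ENNReal.ofReal_coe_nnreal, ENNReal.coe_toNNReal huv.2]
  obtain ⟨q, hq⟩ := this
  exact iInf_le_of_le q hq.le

theorem CliqueMinorFree.mono {G' : SimpleGraph V} {h : ℕ} (hG : CliqueMinorFree G h)
    (hle : G' ≤ G) : CliqueMinorFree G' h := by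
  rintro ⟨B, h₁, h₂, h₃⟩
  refine hG ⟨B, fun a => (h₁ a).mono fun _ _ hadj => hle hadj, h₂, fun a b hab => ?_⟩
  obtain ⟨u, hu, v, hv, huv⟩ := h₃ a b hab
  exact ⟨u, hu, v, hv, hle huv⟩

theorem CliqueMinorFree.isEmpty (hG : CliqueMinorFree G 1) : IsEmpty V := by
  by_contra hV
  obtain ⟨v⟩ := not_isEmpty_iff.1 hV
  refine hG ⟨fun _ => {v}, fun _ => ?_, fun a b hab => ?_, fun a b hab => ?_⟩
  · rw [SimpleGraph.connected_iff_exists_forall_reachable]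
    exact ⟨⟨v, rfl⟩, fun ⟨x, hx⟩ => by
      obtain rfl : x = v := hx
      exact .refl _⟩
  · exact absurd (Subsingleton.elim a b) hab
  · exact absurd (Subsingleton.elim a b) hab.ne

theorem CliqueMinorFree.not_adj (hG : CliqueMinorFree G 2) (u v : V) : ¬ G.Adj u v := by
  intro huv
  refine hG ⟨![{u}, {v}], fun a => ?_, fun a b hab => ?_, fun a b hab => ?_⟩
  · have : ∀ x : V, (G.induce {x}).Connected := fun x => by
      rw [SimpleGraph.connected_iff_exists_forall_reachable]
      exact ⟨⟨x, rfl⟩, fun ⟨y, hy⟩ => by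
        obtain rfl : y = x := hy
        exact .refl _⟩
    fin_cases a
    · exact this u
    · exact this v
  · fin_cases a <;> fin_cases b <;> simp_all [huv.ne, huv.ne.symm]
  · fin_cases a <;> fin_cases b <;> simp_all [huv.symm]

end GraphMetric

/-! ### Bounding ladders. -/

section Ladder

variable {V : Type*} {d : V → V → ℝ≥0∞} {ε r : ℝ} {l : ℕ} {x p : Fin l → V}

/-- The detour `p 1`, `x 2`, `p 0`, `x 1` has length at most `3r ≤ (1 + ε)r`. -/
theorem IsLadderOfWidth.length_le_two (hcomm : ∀ u v, d u v = d v u)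
    (htri : ∀ u v z, d u z ≤ d u v + d v z) (hr : 0 < r) (hε : 2 ≤ ε)
    (hl : IsLadderOfWidth d ε r x p) : l ≤ 2 := by
  by_contra! hlt
  have h01 := hl.1 ⟨1, by omega⟩ ⟨0, by omega⟩ (by simp)
  have h02 := hl.1 ⟨2, by omega⟩ ⟨0, by omega⟩ (by simp)
  have h12 := hl.1 ⟨2, by omega⟩ ⟨1, by omega⟩ (by simp)
  have h11 := hl.2 ⟨1, by omega⟩
  refine h11.not_ge ?_
  calc d (p ⟨1, by omega⟩) (x ⟨1, by omega⟩)
      ≤ d (p ⟨1, by omega⟩) (x ⟨2, by omega⟩) + (d (x ⟨2, by omega⟩) (p ⟨0, by omega⟩) +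
          d (p ⟨0, by omega⟩) (x ⟨1, by omega⟩)) :=
        (htri _ _ _).trans (add_le_add le_rfl (htri _ _ _))
    _ ≤ ENNReal.ofReal r + (ENNReal.ofReal r + ENNReal.ofReal r) := by
        rw [hcomm (x _) (p _)]
        gcongr
    _ = ENNReal.ofReal (r + (r + r)) := by
        rw [ENNReal.ofReal_add hr.le (by positivity), ENNReal.ofReal_add hr.le hr.le]
    _ ≤ ENNReal.ofReal ((1 + ε) * r) := ENNReal.ofReal_le_ofReal (by nlinarith)

/-- A ladder is short if every two vertices at distance at most `r` have a common center close to
a shortest path between them, where every vertex has at most `c` centers. -/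
theorem IsLadderOfWidth.length_le_of_centers (hcomm : ∀ u v, d u v = d v u)
    (htri : ∀ u v z, d u z ≤ d u v + d v z) (hr : 0 < r) (hε : 0 < ε) {W : V → Finset V} {c : ℕ}
    (hc : 1 ≤ c) (hW : ∀ v, (W v).card ≤ c) (hWd : ∀ v, ∀ m ∈ W v,
      d v m ≤ ENNReal.ofReal ((1 + 3 * ε / 4) * r))
    (hcenter : ∀ u v, d u v ≤ ENNReal.ofReal r → ∃ m ∈ W u, m ∈ W v ∧
      d u m + d v m ≤ ENNReal.ofReal ((1 + 3 * ε / 4) * r))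
    (hl : IsLadderOfWidth d ε r x p) : l ≤ (2 * c * (⌊4 / ε + 3⌋₊ + 1) ^ c) ^ (c + 1) := by
  classical
  set B := ⌊4 / ε + 3⌋₊ + 1 with hB
  have hτ : 0 < ε / 4 * r := by positivity
  have hBpos : 1 ≤ B := by omega
  have hbase : 1 ≤ 2 * c * B ^ c := Nat.mul_pos (by omega) (pow_pos hBpos c)
  -- Here `s` counts the centers still missing to `c + 1`. At `s = 0` no vertex has all of `K` among
  -- its centers, so `I` is empty.
  have main : ∀ (s : ℕ) (I : Finset (Fin l)) (K : Finset V), K.card + s = c + 1 →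
      (∀ i ∈ I, K ⊆ W (x i)) → I.card ≤ (2 * c * B ^ c) ^ s := by
    intro s
    induction s with
    | zero =>
      intro I K hK hI
      rcases I.eq_empty_or_nonempty with rfl | ⟨i, hi⟩
      · simp
      · have := (Finset.card_le_card (hI i hi)).trans (hW _)
        omega
    | succ s ih =>
      intro I K hK hI
      set T := (2 * c * B ^ c) ^ s with hT
      have hT1 : 1 ≤ T := Nat.one_le_pow _ _ hbase
      have hfloor : ∀ i ∈ I, ∀ m ∈ K, ⌊(d (x i) m).toReal / (ε / 4 * r)⌋₊ < B := by
        intro i hi m hm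
        have h₁ := ENNReal.toReal_le_of_le_ofReal (by positivity) (hWd _ m (hI i hi hm))
        rw [hB, Nat.lt_succ_iff]
        refine Nat.floor_le_floor ?_
        rw [div_le_iff₀ hτ]
        refine h₁.trans (le_of_eq ?_)
        field_simp
      -- The remainder only makes the colouring total; on `I` the floors are already below `B` by
      -- `hfloor`.
      let φ : Fin l → K → Fin B := fun i m =>
        ⟨⌊(d (x i) m).toReal / (ε / 4 * r)⌋₊ % B, Nat.mod_lt _ hBpos⟩
      have hfiber : ∀ b ∈ (Finset.univ : Finset (K → Fin B)),
          (I.filter fun i => φ i = b).card ≤ c * T + 1 := by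
        intro b _
        rcases (I.filter fun i => φ i = b).eq_empty_or_nonempty with he | hne
        · simp [he]
        obtain ⟨j, hj, hjmin⟩ := Finset.exists_min_image _ id hne
        simp only [id] at hjmin
        have hsub : (I.filter fun i => φ i = b) ⊆ insert j ((W (p j) \ K).biUnion fun m =>
            I.filter fun i => m ∈ W (x i)) := by
          intro i hi
          rw [Finset.mem_insert]
          by_cases hij : i = j
          · exact .inl hij
          have hji : j < i := lt_of_le_of_ne (hjmin i hi) (Ne.symm hij)
          obtain ⟨m, hmp, hmx, hd⟩ := hcenter _ _ (hl.1 i j hji)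
          refine .inr (Finset.mem_biUnion.2 ⟨m, Finset.mem_sdiff.2 ⟨hmp, fun hmK => ?_⟩,
            Finset.mem_filter.2 ⟨(Finset.mem_filter.1 hi).1, hmx⟩⟩)
          obtain ⟨hiI, hib⟩ := Finset.mem_filter.1 hi
          obtain ⟨hjI, hjb⟩ := Finset.mem_filter.1 hj
          have hφ : φ j ⟨m, hmK⟩ = φ i ⟨m, hmK⟩ := by rw [hib, hjb]
          have hfl : ⌊(d (x j) m).toReal / (ε / 4 * r)⌋₊ =
              ⌊(d (x i) m).toReal / (ε / 4 * r)⌋₊ := by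
            have := Fin.ext_iff.1 hφ
            simp only [φ] at this
            rwa [Nat.mod_eq_of_lt (hfloor j hjI m hmK), Nat.mod_eq_of_lt (hfloor i hiI m hmK)]
              at this
          have hle : (d (x j) m).toReal ≤ (d (x i) m).toReal + ε / 4 * r := by
            have h₁ := Nat.lt_floor_add_one ((d (x j) m).toReal / (ε / 4 * r))
            have h₂ := Nat.floor_le (a := (d (x i) m).toReal / (ε / 4 * r)) (by positivity)
            rw [hfl, div_lt_iff₀ hτ] at h₁
            rw [le_div_iff₀ hτ] at h₂
            linarith
          have hfin : ∀ i ∈ I, d (x i) m ≠ ∞ := fun i hi =>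
            ne_top_of_le_ne_top ENNReal.ofReal_ne_top (hWd _ m (hI i hi hmK))
          have hdle : d (x j) m ≤ d (x i) m + ENNReal.ofReal (ε / 4 * r) := by
            rw [← ENNReal.ofReal_toReal (hfin i hiI), ← ENNReal.ofReal_toReal (hfin j hjI),
              ← ENNReal.ofReal_add ENNReal.toReal_nonneg hτ.le]
            exact ENNReal.ofReal_le_ofReal hle
          refine (hl.2 j).not_ge ?_
          calc d (p j) (x j) ≤ d (p j) m + d m (x j) := htri _ _ _
            _ ≤ d (p j) m + (d (x i) m + ENNReal.ofReal (ε / 4 * r)) := by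
                rw [hcomm m]; gcongr
            _ ≤ ENNReal.ofReal ((1 + 3 * ε / 4) * r) + ENNReal.ofReal (ε / 4 * r) := by
                rw [← add_assoc]; gcongr
            _ = ENNReal.ofReal ((1 + ε) * r) := by
                rw [← ENNReal.ofReal_add (by positivity) hτ.le]
                congr 1
                ring
        calc (I.filter fun i => φ i = b).card ≤ _ := Finset.card_le_card hsub
          _ ≤ _ := Finset.card_insert_le _ _
          _ ≤ c * T + 1 := by
            gcongr
            refine (Finset.card_biUnion_le_card_mul _ _ T fun m hm => ?_).trans
              (Nat.mul_le_mul_right _ ((Finset.card_le_card Finset.sdiff_subset).trans (hW _)))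
            refine ih _ (insert m K) ?_ fun i hi => ?_
            · rw [Finset.card_insert_of_notMem (Finset.mem_sdiff.1 hm).2]
              omega
            · obtain ⟨hiI, hmi⟩ := Finset.mem_filter.1 hi
              exact Finset.insert_subset hmi (hI i hiI)
      have hcard := Finset.card_le_mul_card_image_of_maps_to
        (fun i (_ : i ∈ I) => Finset.mem_univ (φ i)) (c * T + 1) hfiber
      have huniv : (Finset.univ : Finset (K → Fin B)).card = B ^ K.card := by simp
      rw [huniv] at hcard
      calc I.card ≤ (c * T + 1) * B ^ K.card := hcard
        _ ≤ (c * T + c * T) * B ^ c := by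
          gcongr
          · exact Nat.mul_pos hc hT1
          · omega
        _ = (2 * c * B ^ c) ^ (s + 1) := by rw [pow_succ, ← hT]; ring
  have := main (c + 1) Finset.univ ∅ (by simp) (by simp)
  simpa using this

theorem scatterDim_le {b : ℝ} (hb : 0 ≤ b)
    (H : ∀ (l : ℕ) (x p : Fin l → V), IsLadder d ε x p → (l : ℝ) ≤ b) :
    (scatterDim d ε : ℝ≥0∞) ≤ ENNReal.ofReal b := by
  have h₁ : scatterDim d ε ≤ (⌊b⌋₊ : ℕ∞) := by
    refine iSup₂_le fun l ⟨x, p, hl⟩ => ?_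
    exact_mod_cast Nat.le_floor (H l x p hl)
  calc (scatterDim d ε : ℝ≥0∞) ≤ ((⌊b⌋₊ : ℕ∞) : ℝ≥0∞) := by exact_mod_cast h₁
    _ = ENNReal.ofReal (⌊b⌋₊ : ℝ) := by simp
    _ ≤ ENNReal.ofReal b := ENNReal.ofReal_le_ofReal (Nat.floor_le hb)

end Ladder

/-! ### Numerical estimates. -/

section Bounds

theorem reachBound_nonneg {h : ℕ} {ε : ℝ} (hh : 1 ≤ h) (hε : 0 < ε) : 0 ≤ reachBound h ε := by
  have : (1 : ℝ) ≤ h := by exact_mod_cast hh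
  have : (0 : ℝ) ≤ (h : ℝ) - 1 := by linarith
  unfold reachBound
  positivity

theorem scatterBound_nonneg {h : ℕ} {ε : ℝ} (hh : 1 ≤ h) (hε : 0 < ε) :
    0 ≤ scatterBound h ε := by
  have := reachBound_nonneg hh hε
  unfold scatterBound
  positivity

theorem choose_mul_le_reachBound {h : ℕ} {ε : ℝ} (hh : 2 ≤ h) (hε : 0 < ε) (hε2 : ε < 2) :
    (((2 * ⌈10 * h / ε⌉₊ + 1 + (h - 2)).choose (h - 2) * ((h - 1) * ⌈16 / ε + 6⌉₊) : ℕ) : ℝ) ≤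
      reachBound h ε := by
  have hh' : (2 : ℝ) ≤ h := by exact_mod_cast hh
  have hinv : 1 / 2 < ε⁻¹ := by
    rw [one_div]
    exact (inv_lt_inv₀ two_pos hε).2 hε2
  have hhinv : 1 < h * ε⁻¹ := by nlinarith
  have h₁ : ((h - 1 : ℕ) : ℝ) = (h : ℝ) - 1 := by
    rw [Nat.cast_sub (by omega), Nat.cast_one]
  have h₂ : (⌈16 / ε + 6⌉₊ : ℝ) ≤ 12 + 72 * ε⁻¹ := by
    have := Nat.ceil_lt_add_one (a := 16 / ε + 6) (by positivity)
    rw [div_eq_mul_inv] at this ⊢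
    linarith
  have h₃ : 2 * ⌈10 * h / ε⌉₊ + 2 ≤ 2 * ⌈36 * (h : ℝ) * ε⁻¹⌉₊ := by
    have h₄ := Nat.ceil_lt_add_one (a := 10 * h / ε) (by positivity)
    have h₅ := Nat.le_ceil (36 * (h : ℝ) * ε⁻¹)
    rw [div_eq_mul_inv] at h₄ ⊢
    have : (⌈10 * h * ε⁻¹⌉₊ : ℝ) + 1 ≤ ⌈36 * (h : ℝ) * ε⁻¹⌉₊ := by linarith
    have : ⌈10 * h * ε⁻¹⌉₊ + 1 ≤ ⌈36 * (h : ℝ) * ε⁻¹⌉₊ := by exact_mod_cast this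
    omega
  have h₆ : (2 * ⌈10 * h / ε⌉₊ + 1 + (h - 2)).choose (h - 2) ≤
      (h + 2 * ⌈36 * (h : ℝ) * ε⁻¹⌉₊ - 2).choose (h - 1) := by
    obtain ⟨k, rfl⟩ : ∃ k, h = k + 2 := ⟨h - 2, by omega⟩
    calc _ ≤ (2 * ⌈10 * ((k + 2 : ℕ) : ℝ) / ε⌉₊ + 1 + k).choose k +
          (2 * ⌈10 * ((k + 2 : ℕ) : ℝ) / ε⌉₊ + 1 + k).choose (k + 1) := Nat.le_add_right _ _
      _ = (2 * ⌈10 * ((k + 2 : ℕ) : ℝ) / ε⌉₊ + 1 + k + 1).choose (k + 1) :=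
          (Nat.choose_succ_succ _ _).symm
      _ ≤ _ := Nat.choose_le_choose _ (by omega)
  push_cast
  rw [h₁, reachBound, mul_comm ((h : ℝ) - 1), ← mul_assoc]
  have : (0 : ℝ) ≤ (h : ℝ) - 1 := by linarith
  gcongr

theorem ladder_bound_le_scatterBound {h c : ℕ} {ε : ℝ} (hc : 1 ≤ c) (hε : 0 < ε) (hε2 : ε < 2)
    (hcr : (c : ℝ) ≤ reachBound h ε) :
    (((2 * c * (⌊4 / ε + 3⌋₊ + 1) ^ c) ^ (c + 1) : ℕ) : ℝ) ≤ scatterBound h ε := by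
  set ρ := reachBound h ε
  have hc1 : (1 : ℝ) ≤ c := by exact_mod_cast hc
  have hinv : 1 / 2 < ε⁻¹ := by
    rw [one_div]
    exact (inv_lt_inv₀ two_pos hε).2 hε2
  have hB : ((⌊4 / ε + 3⌋₊ : ℝ) + 1) ≤ 9 * ε⁻¹ + 2 := by
    have := Nat.floor_le (a := 4 / ε + 3) (by positivity)
    rw [div_eq_mul_inv] at this ⊢
    linarith
  have h1 : (1 : ℝ) ≤ 9 * ε⁻¹ + 2 := by linarith
  have hpow : ((⌊4 / ε + 3⌋₊ : ℝ) + 1) ^ c ≤ (9 * ε⁻¹ + 2) ^ ρ := by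
    calc ((⌊4 / ε + 3⌋₊ : ℝ) + 1) ^ c ≤ (9 * ε⁻¹ + 2) ^ c := by gcongr
      _ = (9 * ε⁻¹ + 2) ^ (c : ℝ) := (Real.rpow_natCast _ _).symm
      _ ≤ _ := Real.rpow_le_rpow_of_exponent_le h1 hcr
  have hpow1 : 1 ≤ (9 * ε⁻¹ + 2) ^ ρ := Real.one_le_rpow h1 (by linarith)
  have hbase : 2 * (c : ℝ) * ((⌊4 / ε + 3⌋₊ : ℝ) + 1) ^ c ≤ 6 * ρ * (9 * ε⁻¹ + 2) ^ ρ := by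
    gcongr <;> linarith
  push_cast
  unfold scatterBound
  calc (2 * (c : ℝ) * ((⌊4 / ε + 3⌋₊ : ℝ) + 1) ^ c) ^ (c + 1)
      ≤ (6 * ρ * (9 * ε⁻¹ + 2) ^ ρ) ^ (c + 1) := by gcongr
    _ = (6 * ρ * (9 * ε⁻¹ + 2) ^ ρ) ^ ((c : ℝ) + 1) := by
        rw [← Real.rpow_natCast]; push_cast; rfl
    _ ≤ _ := Real.rpow_le_rpow_of_exponent_le (by nlinarith) (by linarith)

theorem le_two_rpow {x : ℝ} (hx : 0 ≤ x) : x ≤ (2 : ℝ) ^ x := by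
  have h₁ : (⌊x⌋₊ : ℝ) + 1 ≤ 2 ^ ⌊x⌋₊ := by exact_mod_cast Nat.lt_two_pow_self (n := ⌊x⌋₊)
  calc x ≤ ⌊x⌋₊ + 1 := (Nat.lt_floor_add_one x).le
    _ ≤ (2 : ℝ) ^ (⌊x⌋₊ : ℝ) := by rw [Real.rpow_natCast]; exact h₁
    _ ≤ _ := Real.rpow_le_rpow_of_exponent_le one_le_two (Nat.floor_le hx)

theorem two_le_scatterBound {h : ℕ} {ε : ℝ} (hh : 2 ≤ h) (hε : 0 < ε) :
    2 ≤ scatterBound h ε := by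
  have hh' : (2 : ℝ) ≤ h := by exact_mod_cast hh
  have hceil : 1 ≤ ⌈36 * (h : ℝ) * ε⁻¹⌉₊ := Nat.one_le_iff_ne_zero.2
    (Nat.ceil_pos.2 (by positivity)).ne'
  have hchoose : (1 : ℝ) ≤ ((h + 2 * ⌈36 * (h : ℝ) * ε⁻¹⌉₊ - 2).choose (h - 1) : ℝ) := by
    exact Nat.one_le_cast.2 (Nat.choose_pos (by omega))
  have hinv : 0 < ε⁻¹ := inv_pos.2 hε
  have hρ : 1 ≤ reachBound h ε := by
    unfold reachBound
    have h₁ : (1 : ℝ) ≤ 12 + 72 * ε⁻¹ := by linarith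
    have h₂ : (1 : ℝ) ≤ (h : ℝ) - 1 := by linarith
    exact one_le_mul_of_one_le_of_one_le (one_le_mul_of_one_le_of_one_le hchoose h₁) h₂
  have h₃ : 1 ≤ (9 * ε⁻¹ + 2) ^ reachBound h ε := Real.one_le_rpow (by linarith) (by linarith)
  have h₄ : 2 ≤ 6 * reachBound h ε * (9 * ε⁻¹ + 2) ^ reachBound h ε := by nlinarith
  exact h₄.trans (Real.self_le_rpow_of_one_le (by linarith) (by linarith))

/-- With `t = h/ε ≥ 3/2`, the bound is a product of `h + 1` factors of size at most `74t ≤ t ^ 12`,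
and `12(h + 1) ≤ 16h` for `h ≥ 3`. -/
theorem reachBound_le_pow {h : ℕ} {ε : ℝ} (hh : 3 ≤ h) (hε : 0 < ε) (hε2 : ε < 2) :
    reachBound h ε ≤ (h * ε⁻¹) ^ (16 * h) := by
  have hh' : (3 : ℝ) ≤ h := by exact_mod_cast hh
  have hinv : 1 / 2 < ε⁻¹ := by
    rw [one_div]
    exact (inv_lt_inv₀ two_pos hε).2 hε2
  set t := (h : ℝ) * ε⁻¹ with ht
  have ht1 : 3 / 2 ≤ t := by rw [ht]; nlinarith
  have hht : (h : ℝ) ≤ 2 * t := by rw [ht]; nlinarith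
  have hεt : ε⁻¹ ≤ t / 3 := by rw [ht]; nlinarith
  have hn : ((h + 2 * ⌈36 * (h : ℝ) * ε⁻¹⌉₊ - 2 : ℕ) : ℝ) ≤ 74 * t := by
    have h₁ := Nat.ceil_lt_add_one (a := 36 * (h : ℝ) * ε⁻¹) (by positivity)
    rw [Nat.cast_sub (by omega)]
    push_cast
    rw [mul_assoc, ← ht] at h₁ ⊢
    linarith
  have hchoose : ((h + 2 * ⌈36 * (h : ℝ) * ε⁻¹⌉₊ - 2).choose (h - 1) : ℝ) ≤
      (74 * t) ^ (h - 1) := by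
    calc ((h + 2 * ⌈36 * (h : ℝ) * ε⁻¹⌉₊ - 2).choose (h - 1) : ℝ)
        ≤ ((h + 2 * ⌈36 * (h : ℝ) * ε⁻¹⌉₊ - 2 : ℕ) : ℝ) ^ (h - 1) := by
          exact_mod_cast Nat.choose_le_pow _ _
      _ ≤ _ := by gcongr
  have h74 : 74 * t ≤ t ^ 12 := by
    have : (74 : ℝ) ≤ t ^ 11 :=
      (by norm_num : (74 : ℝ) ≤ (3 / 2) ^ 11).trans (by gcongr)
    calc 74 * t ≤ t ^ 11 * t := by gcongr
      _ = t ^ 12 := by ring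
  unfold reachBound
  calc ((h + 2 * ⌈36 * (h : ℝ) * ε⁻¹⌉₊ - 2).choose (h - 1) : ℝ) * (12 + 72 * ε⁻¹) * ((h : ℝ) - 1)
      ≤ (74 * t) ^ (h - 1) * (74 * t) * (74 * t) := by
        gcongr
        · linarith
        · linarith
        · linarith
    _ = (74 * t) ^ (h + 1) := by
        rw [← pow_succ, ← pow_succ]
        congr 1
        omega
    _ ≤ (t ^ 12) ^ (h + 1) := by gcongr
    _ = t ^ (12 * (h + 1)) := (pow_mul _ _ _).symm
    _ ≤ t ^ (16 * h) := pow_le_pow_right₀ (by linarith) (by omega)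

/-- The binary logarithm is at most `(6 + 5t)ρ(ρ + 1) ≤ 22 * t ^ (1 + 32h)`. The factor `22` costs
`t ^ 8`, and `9 + 32h ≤ 35h` for `h ≥ 3`. -/
theorem scatterBound_le_two_rpow {h : ℕ} {ε : ℝ} (hh : 3 ≤ h) (hε : 0 < ε) (hε2 : ε < 2) :
    scatterBound h ε ≤ (2 : ℝ) ^ ((h * ε⁻¹) ^ (35 * h)) := by
  have hh' : (3 : ℝ) ≤ h := by exact_mod_cast hh
  have hρ₀ := reachBound_nonneg (by omega : 1 ≤ h) hε
  have hρ := reachBound_le_pow hh hε hε2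
  unfold scatterBound
  set ρ := reachBound h ε
  have hinv : 1 / 2 < ε⁻¹ := by
    rw [one_div]
    exact (inv_lt_inv₀ two_pos hε).2 hε2
  set t := (h : ℝ) * ε⁻¹ with ht
  have ht1 : 3 / 2 ≤ t := by rw [ht]; nlinarith
  have hεt : ε⁻¹ ≤ t / 3 := by rw [ht]; nlinarith
  set Z := t ^ (16 * h)
  have hZ : 1 ≤ Z := one_le_pow₀ (by linarith)
  have hK : 9 * ε⁻¹ + 2 ≤ (2 : ℝ) ^ (5 * t) := by
    refine le_trans ?_ (le_two_rpow (by linarith))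
    linarith
  have hbase : 6 * ρ * (9 * ε⁻¹ + 2) ^ ρ ≤ (2 : ℝ) ^ ((6 + 5 * t) * ρ) := by
    calc 6 * ρ * (9 * ε⁻¹ + 2) ^ ρ ≤ (2 : ℝ) ^ (6 * ρ) * ((2 : ℝ) ^ (5 * t)) ^ ρ := by
          gcongr
          exact le_two_rpow (by positivity)
      _ = _ := by
        rw [← Real.rpow_mul two_pos.le, ← Real.rpow_add two_pos]
        congr 1
        ring
  have hexp : (6 + 5 * t) * ρ * (ρ + 1) ≤ t ^ (35 * h) := by
    have h22 : (22 : ℝ) ≤ t ^ 8 :=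
      (by norm_num : (22 : ℝ) ≤ (3 / 2) ^ 8).trans (by gcongr)
    calc (6 + 5 * t) * ρ * (ρ + 1) ≤ (11 * t) * Z * (Z + Z) := by
          gcongr
          linarith
      _ = 22 * (t * Z * Z) := by ring
      _ ≤ t ^ 8 * (t * Z * Z) := by gcongr
      _ = t ^ (8 + 1 + 16 * h + 16 * h) := by simp only [Z, pow_add, pow_one]; ring
      _ ≤ t ^ (35 * h) := pow_le_pow_right₀ (by linarith) (by omega)
  calc (6 * ρ * (9 * ε⁻¹ + 2) ^ ρ) ^ (ρ + 1)
      ≤ ((2 : ℝ) ^ ((6 + 5 * t) * ρ)) ^ (ρ + 1) :=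
        Real.rpow_le_rpow (by positivity) hbase (by positivity)
    _ = (2 : ℝ) ^ ((6 + 5 * t) * ρ * (ρ + 1)) := (Real.rpow_mul two_pos.le _ _).symm
    _ ≤ _ := Real.rpow_le_rpow_of_exponent_le one_le_two hexp

end Bounds

/-! ### Choice of parameters and small cases. -/

section Main

variable {V : Type*} {G : SimpleGraph V} {w : Sym2 V → ℝ≥0∞} {ε : ℝ} {h l : ℕ} {x p : Fin l → V}

/-- Every vertex of a `K_h`-minor-free graph has few centers such that vertices at distance at most
`r` have a common center close to a shortest path between them. -/
theorem exists_metric_centers [Finite V] (hh : 2 ≤ h) (hε : 0 < ε) (hε2 : ε < 2)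
    (hG : CliqueMinorFree G h) {r : ℝ} (hr : 0 < r) :
    ∃ W : V → Finset V,
      (∀ v, (W v).card ≤
        (2 * ⌈10 * h / ε⌉₊ + 1 + (h - 2)).choose (h - 2) * ((h - 1) * ⌈16 / ε + 6⌉₊)) ∧
      (∀ v, ∀ m ∈ W v, graphMetric G w v m ≤ ENNReal.ofReal ((1 + 3 * ε / 4) * r)) ∧
      ∀ u v, graphMetric G w u v ≤ ENNReal.ofReal r → ∃ m ∈ W u, m ∈ W v ∧
        graphMetric G w u m + graphMetric G w v m ≤ ENNReal.ofReal ((1 + 3 * ε / 4) * r) := by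
  classical
  rcases isEmpty_or_nonempty V with hV | hV
  · exact ⟨fun _ => ∅, by simp, by simp, fun u => hV.elim u⟩
  have hh' : (2 : ℝ) ≤ h := by exact_mod_cast hh
  -- Error budget: `εr/8` for the walk, plus twice `γh + δ + η = εr/8 + εr/8 + εr/16`, in total
  -- `3εr/4`.
  set γ := ε * r / (8 * h) with hγdef
  have hγ : 0 < γ := by positivity
  have hγh : γ * h = ε * r / 8 := by rw [hγdef]; field_simp
  obtain ⟨P, hP⟩ := PartialDecomp.exists_total (w := fun e => (w e).toNNReal) (η := ε * r / 16)
    hγ.le (by positivity) hh (hG.mono (finiteWeightGraph_le (w := w)))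
  -- The exact ratio is `8h/ε + h`, at most `10h/ε` because `ε < 2`.
  have hR : (1 + ε / 8) * r ≤ ⌈10 * h / ε⌉₊ * γ := by
    calc (1 + ε / 8) * r ≤ 10 * h / ε * γ := by
          rw [hγdef]
          field_simp
          linarith
      _ ≤ _ := by gcongr; exact Nat.le_ceil _
  have hN : 2 * ((1 + ε / 8) * r + γ * h) / (ε * r / 8) + 2 ≤ ⌈16 / ε + 6⌉₊ := by
    refine le_trans (le_of_eq ?_) (Nat.le_ceil _)
    rw [hγh]
    field_simp
    ring
  obtain ⟨W, hWcard, hW⟩ := PartialDecomp.exists_centers hP (by positivity) hγ.le hR hN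
  refine ⟨fun v => (W v).filter fun m =>
    graphMetric G w v m ≤ ENNReal.ofReal ((1 + 3 * ε / 4) * r),
    fun v => (Finset.card_filter_le _ _).trans (hWcard v),
    fun v m hm => (Finset.mem_filter.1 hm).2, fun u v huv => ?_⟩
  obtain ⟨L, hL, q⟩ := exists_walkIn_of_graphMetric_lt (huv.trans_lt
    ((ENNReal.ofReal_lt_ofReal_iff (by positivity)).2 (by nlinarith : r < (1 + ε / 8) * r)))
  obtain ⟨m, hmu, hmv, L₁, L₂, q₁, q₂, hsum⟩ := hW u v L hL q
  have hle : graphMetric G w u m + graphMetric G w v m ≤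
      ENNReal.ofReal ((1 + 3 * ε / 4) * r) := by
    calc graphMetric G w u m + graphMetric G w v m ≤ ENNReal.ofReal L₁ + ENNReal.ofReal L₂ :=
          add_le_add (graphMetric_le_of_walkIn q₁) (graphMetric_le_of_walkIn q₂)
      _ = ENNReal.ofReal (L₁ + L₂) := (ENNReal.ofReal_add q₁.nonneg q₂.nonneg).symm
      _ ≤ _ := ENNReal.ofReal_le_ofReal (by rw [hγh] at hsum; linarith)
  exact ⟨m, Finset.mem_filter.2 ⟨hmu, le_self_add.trans hle⟩,
    Finset.mem_filter.2 ⟨hmv, le_add_self.trans hle⟩, hle⟩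

theorem IsLadder.length_le_two_of_two_le (hε : 2 ≤ ε) (hl : IsLadder (graphMetric G w) ε x p) :
    l ≤ 2 := by
  obtain ⟨r, hr, hl⟩ := hl
  exact hl.length_le_two graphMetric_comm graphMetric_triangle hr hε

theorem CliqueMinorFree.length_eq_zero (hG : CliqueMinorFree G 1)
    (x : Fin l → V) : l = 0 := by
  have := hG.isEmpty
  by_contra hl
  exact isEmptyElim (x ⟨0, Nat.pos_of_ne_zero hl⟩)

/-- Finite distance now means equality, so a third pair would force `p 1 = x 2 = p 0 = x 1`. -/
theorem IsLadder.length_le_two_of_edgeless (hG : ∀ u v, ¬ G.Adj u v)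
    (hl : IsLadder (graphMetric G w) ε x p) : l ≤ 2 := by
  obtain ⟨r, hr, hl⟩ := hl
  have heq : ∀ u v, graphMetric G w u v ≤ ENNReal.ofReal r → u = v := by
    intro u v huv
    obtain ⟨q, -⟩ := iInf_lt_iff.1 (huv.trans_lt ENNReal.ofReal_lt_top)
    cases q with
    | nil => rfl
    | cons huv _ => exact absurd huv (hG _ _)
  by_contra! hlt
  have h01 := heq _ _ (hl.1 ⟨1, by omega⟩ ⟨0, by omega⟩ (by simp))
  have h02 := heq _ _ (hl.1 ⟨2, by omega⟩ ⟨0, by omega⟩ (by simp))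
  have h12 := heq _ _ (hl.1 ⟨2, by omega⟩ ⟨1, by omega⟩ (by simp))
  have h11 := hl.2 ⟨1, by omega⟩
  rw [h12, ← h02, h01, graphMetric_self] at h11
  exact not_lt_zero h11

theorem IsLadder.length_le_scatterBound [Finite V] (hh : 1 ≤ h) (hε : 0 < ε)
    (hG : CliqueMinorFree G h) (hl : IsLadder (graphMetric G w) ε x p) :
    (l : ℝ) ≤ scatterBound h ε := by
  rcases hh.eq_or_lt with rfl | hh
  · rw [hG.length_eq_zero x, Nat.cast_zero]
    exact scatterBound_nonneg le_rfl hε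
  rcases le_or_gt 2 ε with hε2 | hε2
  · refine le_trans ?_ (two_le_scatterBound hh hε)
    exact_mod_cast hl.length_le_two_of_two_le hε2
  obtain ⟨r, hr, hl⟩ := hl
  obtain ⟨W, hWcard, hWd, hW⟩ := exists_metric_centers (w := w) hh hε hε2 hG hr
  have hc : 1 ≤ (2 * ⌈10 * h / ε⌉₊ + 1 + (h - 2)).choose (h - 2) *
      ((h - 1) * ⌈16 / ε + 6⌉₊) :=
    Nat.mul_pos (Nat.choose_pos (by omega))
      (Nat.mul_pos (by omega) (Nat.ceil_pos.2 (by positivity)))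
  have := hl.length_le_of_centers graphMetric_comm graphMetric_triangle hr hε hc hWcard hWd hW
  exact (Nat.cast_le.2 this).trans
    (ladder_bound_le_scatterBound hc hε hε2 (choose_mul_le_reachBound hh hε hε2))

theorem IsLadder.length_le_two_rpow [Finite V] (hh : 1 ≤ h) (hε : 0 < ε) (hεh : ε ≤ h)
    (hG : CliqueMinorFree G h) (hl : IsLadder (graphMetric G w) ε x p) :
    (l : ℝ) ≤ (2 : ℝ) ^ ((h * ε⁻¹) ^ (35 * h)) := by
  -- Length at most `2` is free since `ε ≤ h` makes the exponent at least `1`. Longer ladders force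
  -- `ε < 2` and `h ≥ 3`, which keeps `h/ε` away from `1`, so constants are absorbed into its
  -- powers.
  by_cases hl2 : l ≤ 2
  · have ht : 1 ≤ h * ε⁻¹ := by rwa [← div_eq_mul_inv, one_le_div hε]
    calc (l : ℝ) ≤ 2 := by exact_mod_cast hl2
      _ ≤ _ := Real.self_le_rpow_of_one_le one_le_two (one_le_pow₀ ht)
  have hε2 : ε < 2 := by
    by_contra! hε2
    exact hl2 (hl.length_le_two_of_two_le hε2)
  have hh3 : 3 ≤ h := by
    by_contra! hlt
    obtain rfl | rfl : h = 1 ∨ h = 2 := by omega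
    · have := hG.length_eq_zero x
      omega
    · exact hl2 (hl.length_le_two_of_edgeless hG.not_adj)
  exact (hl.length_le_scatterBound hh hε hG).trans (scatterBound_le_two_rpow hh3 hε hε2)

end Main

theorem theorem1 :
    (∀ (h : ℕ) (ε : ℝ), 1 ≤ h → 0 < ε →
      ∀ (V : Type u) [Finite V] (G : SimpleGraph V) (w : Sym2 V → ℝ≥0∞), CliqueMinorFree G h →
        (scatterDim (graphMetric G w) ε : ℝ≥0∞) ≤ ENNReal.ofReal (scatterBound h ε)) ∧
    (∃ C : ℕ, ∀ (h : ℕ) (ε : ℝ), 1 ≤ h → 0 < ε → ε ≤ h →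
      ∀ (V : Type u) [Finite V] (G : SimpleGraph V) (w : Sym2 V → ℝ≥0∞), CliqueMinorFree G h →
        (scatterDim (graphMetric G w) ε : ℝ≥0∞) ≤
          ENNReal.ofReal ((2 : ℝ) ^ (((h : ℝ) * ε⁻¹) ^ (C * h)))) :=
  ⟨fun _ _ hh hε _ _ _ _ hG => scatterDim_le (scatterBound_nonneg hh hε) fun _ _ _ hl =>
      hl.length_le_scatterBound hh hε hG,
    35, fun _ _ hh hε hεh _ _ _ _ hG => scatterDim_le (by positivity) fun _ _ _ hl =>
      hl.length_le_two_rpow hh hε hεh hG⟩
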